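/- **Setting.** Let $1\le K_{\max}\le n\le N$. Let $A\in\{0,1\}^{N\times N}$ be the adjacency matrix of a simple undirected graph on $N$ nodes, for instance any realization of a stochastic block model (SBM) or of a degree-corrected stochastic block model (DCSBM). Let $\mathcal S$ be the set of selected nodes and $A^{\mathcal S}=(A_{ij})_{i\in[N],\,j\in\mathcal S}$. Let $E=\{(i,j): j\in\mathcal S,\ (i\in\mathcal S\Rightarrow i<j)\}$ and $M=|E|=Nn-n(n+1)/2$. For labels $g\in[K]^N$ and weights $\psi\in\mathbb R^N$, let $E_{kl}$ be the set of $(i,j)\in E$ with $(g_i,g_j)\in\{(k,l),(l,k)\}$. Put $o_{kl}=\sum_{E_{kl}}A_{ij}$, $n_{kl}=|E_{kl}|$ and $n_{kl}(\psi)=\sum_{E_{kl}}\psi_i\psi_j$. **SM-BIC.** Fix iteration numbers $q,T\ge 0$. For each candidate $1\le K\le K_{\max}$: 1. *Truncated SVD.* The columns of the $N\times K$ matrix $V$, with rows $v_1,\dots,v_N$, are the approximate $K$ leading left singular vectors of $A^{\mathcal S}$ obtained by $q$ steps of orthogonal iteration: $V^{(0)}=\mathrm{orth}(A^{\mathcal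 S}X)$, $V^{(t+1)}=\mathrm{orth}(A^{\mathcal S}(A^{\mathcal S})^\top V^{(t)})$, $V=V^{(q)}$. Here $\mathrm{orth}$ is Gram–Schmidt orthonormalization of the columns, and $X\in\mathbb R^{n\times K}$ is a random start with independent uniform entries on $[-1,1)$; for all $K$ it consists of the first $K$ columns of one common $n\times K_{\max}$ block. 2. *Clustering.* Labels $\widehat g$ come from $K$-means ($T$ Lloyd rounds, started at a simple random sample of $K$ points). The points are $v_1,\dots,v_N$ for the SBM and the normalized rows $v_i/\|v_i\|$ for the DCSBM. 3. *Plug-in estimation.* For the SBM, $\widehat B_{kl}=o_{kl}/n_{kl}$. For the DCSBM, $\widehat\psi_i=\|v_i\|$ and $\widehat B_{kl}=o_{kl}/n_{kl}(\widehat\psi)$. 4. *Criterion.* $\widehat\ell(K)=\log f-\big\{n\log K+\tfrac{K(K+1)}4\log M\big\}$, where - for the SBM, $\log f=\sum_{k\le l}\{o_{kl}\log\widehat B_{kl}+(n_{kl}-o_{kl})\log(1-\widehat B_{kl})\}$; - for the DCSBM, $\log f=\sum_{(i,j)\in E}A_{ij}\log(\widehat\psi_i\widehat\psi_j)+\sum_{k\le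 l}\{o_{kl}\log\widehat B_{kl}-n_{kl}(\widehat\psi)\widehat B_{kl}\}$. (In degenerate cases $x/0$ and $\log 0$ are read as $0$.) The output is a maximizer $\widehat K$ of $\widehat\ell$ over $1\le K\le K_{\max}$. **Machine.** Running time is counted on a randomized real RAM. It has natural-number and real registers and arrays, with unit cost for addition and truncated subtraction of naturals, for $+,-,\times,/,\sqrt{\ },\log$ on reals, for conversion of a natural number to a real, for array access, for comparisons, and for independent uniform draws from $[0,1)$. The input consists of $N,n,K_{\max},q,T$ and random access to the entries of $A$. **Proposition.** (a) Let $\mathcal S$ be selected by sequential selection from $N$ independent uniform draws: if $c$ of the first $i$ nodes have been selected, the next one is selected when $(N-i)U<n-c$ for a new draw $U$. Then $\mathcal S$ is a simple random sample: $P(\mathcal S=U)=\binom Nn^{-1}$ for every set $U$ of $n$ of the $N$ nodes. (b) For each of the two models, SBM and DCSBM, there is one program for this machine with the following property. For all $K_{\max}\ge1$, $q$, $T$ there is a constant $C$, depending only on $K_{\max},q,T$, such that for all $N\ge n\ge K_{\max}$, all graphs and all outcomes of the draws, the program halts after at most $C\,Nn$ steps with output a maximizer $\widehat K$ of the SM-BIC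 $\widehat\ell$ over $\{1,\dots,K_{\max}\}$. The step count covers the sampling of $\mathcal S$ as in (a), the formation of $A^{\mathcal S}$, the truncated SVD and $K$-means, the plug-in estimation, and the evaluation of $\widehat\ell(K)$ for all $K\le K_{\max}$. Hence identifying $K_0$ by SM-BIC takes time $O(Nn)$. -/

import Mathlib

namespace SMBIC

/-! ### The machine: a randomised real RAM with unit-cost steps

Programs are finite pieces of code in a small imperative language.  Index registers and index
arrays hold natural numbers (constants, addition, truncated subtraction and comparison only); real
registers and two-dimensional real arrays hold real numbers.  The only real constants a program can
create are (casts of) natural numbers.  A random draw reads the next entry of a tape of numbers in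
`[0, 1)`.  Every elementary instruction and every evaluation of a test costs one step. -/

/-- The half-open unit interval, the range of one random draw. -/
abbrev UnitIco : Type := Set.Ico (0 : ℝ) 1

/-- A random tape: the sequence of all draws available to a run. -/
abbrev Tape : Type := ℕ → UnitIco

/-- The uniform distribution on `[0, 1)`. -/
noncomputable def uniformIco : MeasureTheory.Measure UnitIco :=
  MeasureTheory.Measure.comap Subtype.val MeasureTheory.volume

instance : MeasureTheory.IsProbabilityMeasure uniformIco :=
  ⟨by
    rw [uniformIco, (MeasurableEmbedding.subtype_coe measurableSet_Ico).comap_apply,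
      Set.image_univ, Subtype.range_coe]
    simp⟩

/-- The law of the tape: independent draws, uniform on `[0, 1)`. -/
noncomputable def tapeLaw : MeasureTheory.Measure Tape :=
  MeasureTheory.Measure.infinitePi (fun _ : ℕ => uniformIco)

/-- The memory of the machine. -/
structure Memory where
  /-- index registers -/
  idx : ℕ → ℕ
  /-- index arrays: `iarr a i` is entry `i` of array number `a` -/
  iarr : ℕ → ℕ → ℕ
  /-- real registers -/
  val : ℕ → ℝ
  /-- real arrays: `varr a i j` is entry `(i, j)` of array number `a` -/
  varr : ℕ → ℕ → ℕ → ℝ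
  /-- number of random draws made so far -/
  draws : ℕ

/-- Elementary instructions.  All arguments are fixed numbers occurring in the program text
(register numbers, array numbers, and the literal `c` of `iconst`). -/
inductive Instr : Type
  | iconst (r c : ℕ)
  | iadd (r s t : ℕ)
  | isub (r s t : ℕ)
  | iload (r a i : ℕ)
  | istore (a i r : ℕ)
  | ofIdx (x r : ℕ)
  | vadd (x y z : ℕ)
  | vsub (x y z : ℕ)
  | vmul (x y z : ℕ)
  | vdiv (x y z : ℕ)
  | vsqrt (x y : ℕ)
  | vlog (x y : ℕ)
  | vload (x a i j : ℕ)
  | vstore (a i j x : ℕ)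
  | draw (x : ℕ)

/-- Assignment to an index register. -/
def Memory.setIdx (m : Memory) (r v : ℕ) : Memory :=
  { m with idx := Function.update m.idx r v }

/-- Assignment to a real register. -/
noncomputable def Memory.setVal (m : Memory) (x : ℕ) (v : ℝ) : Memory :=
  { m with val := Function.update m.val x v }

/-- The effect of one instruction.  Array positions are given by the contents of index
registers. -/
noncomputable def Instr.step (ω : Tape) (m : Memory) : Instr → Memory
  | iconst r c => m.setIdx r c
  | iadd r s t => m.setIdx r (m.idx s + m.idx t)
  | isub r s t => m.setIdx r (m.idx s - m.idx t)
  | iload r a i => m.setIdx r (m.iarr a (m.idx i))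
  | istore a i r =>
      { m with iarr := Function.update m.iarr a
                 (Function.update (m.iarr a) (m.idx i) (m.idx r)) }
  | ofIdx x r => m.setVal x (m.idx r : ℝ)
  | vadd x y z => m.setVal x (m.val y + m.val z)
  | vsub x y z => m.setVal x (m.val y - m.val z)
  | vmul x y z => m.setVal x (m.val y * m.val z)
  | vdiv x y z => m.setVal x (m.val y / m.val z)
  | vsqrt x y => m.setVal x (Real.sqrt (m.val y))
  | vlog x y => m.setVal x (Real.log (m.val y))
  | vload x a i j => m.setVal x (m.varr a (m.idx i) (m.idx j))
  | vstore a i j x =>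
      { m with varr := Function.update m.varr a
                 (Function.update (m.varr a) (m.idx i)
                   (Function.update (m.varr a (m.idx i)) (m.idx j) (m.val x))) }
  | draw x => { m.setVal x (ω m.draws : ℝ) with draws := m.draws + 1 }

/-- Tests: comparison of two index registers or of two real registers. -/
inductive Test : Type
  | ilt (r s : ℕ)
  | vlt (x y : ℕ)

/-- Truth of a test in a memory. -/
def Test.Holds (m : Memory) : Test → Prop
  | ilt r s => m.idx r < m.idx s
  | vlt x y => m.val x < m.val y

/-- Programs. -/
inductive Program : Type
  | nop
  | act (i : Instr)
  | seq (p q : Program)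
  | branch (b : Test) (p q : Program)
  | loop (b : Test) (p : Program)

/-- `Run ω p m t m₁`: with random tape `ω` and initial memory `m`, the program `p` halts after
exactly `t` steps, with final memory `m₁`. -/
inductive Run (ω : Tape) : Program → Memory → ℕ → Memory → Prop
  | nop (m : Memory) : Run ω .nop m 0 m
  | act (i : Instr) (m : Memory) : Run ω (.act i) m 1 (i.step ω m)
  | seq {p q : Program} {m m₁ m₂ : Memory} {s t : ℕ} :
      Run ω p m s m₁ → Run ω q m₁ t m₂ → Run ω (.seq p q) m (s + t) m₂
  | branchTrue {b : Test} {p q : Program} {m m₁ : Memory} {t : ℕ} :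
      b.Holds m → Run ω p m t m₁ → Run ω (.branch b p q) m (1 + t) m₁
  | branchFalse {b : Test} {p q : Program} {m m₁ : Memory} {t : ℕ} :
      ¬ b.Holds m → Run ω q m t m₁ → Run ω (.branch b p q) m (1 + t) m₁
  | loopTrue {b : Test} {p : Program} {m m₁ m₂ : Memory} {s t : ℕ} :
      b.Holds m → Run ω p m s m₁ → Run ω (.loop b p) m₁ t m₂ →
        Run ω (.loop b p) m (1 + s + t) m₂
  | loopFalse {b : Test} {p : Program} {m : Memory} :
      ¬ b.Holds m → Run ω (.loop b p) m 1 m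

/-- The memory at the start: the network size `N`, the subsample size `n`, the largest candidate
`Kmax` and the iteration numbers `q`, `T` are in index registers `0, …, 4`, the adjacency matrix of
the whole network is in real array `0`, everything else is zero. -/
noncomputable def inputMemory (N n Kmax q T : ℕ) (A : Matrix (Fin N) (Fin N) ℝ) : Memory where
  idx r := if r = 0 then N else if r = 1 then n else if r = 2 then Kmax
    else if r = 3 then q else if r = 4 then T else 0
  iarr _ _ := 0
  val _ := 0
  varr a i j := if h : a = 0 ∧ i < N ∧ j < N then A ⟨i, h.2.1⟩ ⟨j, h.2.2⟩ else 0
  draws := 0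

/-! ### Simple random sampling and node-pair subsampling -/

/-- Sequential selection of `m` out of `N` items with uniform numbers `u 0, u 1, …`: the number of
items selected among the first `i` ones.  Item `i` is selected with conditional probability
(number of items still needed) / (number of items still available). -/
noncomputable def selectedBefore (N m : ℕ) (u : ℕ → ℝ) : ℕ → ℕ
  | 0 => 0
  | i + 1 => selectedBefore N m u i +
      (if ((N : ℝ) - i) * u i < (m : ℝ) - selectedBefore N m u i then 1 else 0)

open Classical in
/-- The set of selected items. -/
noncomputable def sample (N m : ℕ) (u : ℕ → ℝ) : Finset (Fin N) :=
  {i | ((N : ℝ) - (i : ℕ)) * u i < (m : ℝ) - selectedBefore N m u i}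

/-- The set of selected nodes, obtained from the first `N` draws. -/
noncomputable def selectedNodes (N n : ℕ) (ω : Tape) : Finset (Fin N) :=
  sample N n (fun i => (ω i : ℝ))

/-- Position of `i` in the increasing enumeration of `S`, counted from `0`. -/
def position {N : ℕ} (S : Finset (Fin N)) (i : Fin N) : ℕ := (S.filter (· < i)).card

/-- The subsampled adjacency matrix: all rows, and the columns of the selected nodes. -/
def subMatrix {N : ℕ} (A : Matrix (Fin N) (Fin N) ℝ) (S : Finset (Fin N)) :
    Matrix (Fin N) S ℝ := A.submatrix id Subtype.val

/-- Node pairs of the independent edge variables of the subsample: pairs of selected nodes, each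
once, and pairs of an unselected and a selected node. -/
def pairs {N : ℕ} (S : Finset (Fin N)) : Finset (Fin N × Fin N) :=
  Finset.univ.filter (fun e => e.2 ∈ S ∧ (e.1 ∈ S → e.1 < e.2))

/-! ### Truncated singular value decomposition -/

/-- Gram–Schmidt orthonormalisation of the columns of a matrix. -/
noncomputable def orthColumns {N K : ℕ} (Y : Matrix (Fin N) (Fin K) ℝ) :
    Matrix (Fin N) (Fin K) ℝ :=
  fun i k => InnerProductSpace.gramSchmidtNormed ℝ
    (fun l : Fin K => (WithLp.toLp 2 (fun r => Y r l) : EuclideanSpace ℝ (Fin N))) k i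

/-- Truncated SVD: `K` approximate leading left singular vectors of `A` (as columns), by `q` steps
of orthogonal iteration with `A Aᵀ`, started from the range of `A` applied to the block `X`. -/
noncomputable def leftVectors {N K : ℕ} {ι : Type} [Fintype ι] (A : Matrix (Fin N) ι ℝ)
    (X : Matrix ι (Fin K) ℝ) : ℕ → Matrix (Fin N) (Fin K) ℝ
  | 0 => orthColumns (A * X)
  | q + 1 => orthColumns (A * (A.transpose * leftVectors A X q))

/-- The random starting block, with independent entries uniform on `[-1, 1)`, obtained from the
`n * Kmax` draws after the first `N` ones; the candidate `K` uses its first `K` columns. -/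
noncomputable def startBlock {N : ℕ} (Kmax K : ℕ) (S : Finset (Fin N)) (ω : Tape) :
    Matrix S (Fin K) ℝ :=
  fun j k => 2 * (ω (N + position S j * Kmax + k) : ℝ) - 1

/-- The embedding of the nodes for the candidate `K`: row `i` of the matrix of left vectors. -/
noncomputable def embedding {N : ℕ} (A : Matrix (Fin N) (Fin N) ℝ) (S : Finset (Fin N))
    (Kmax q : ℕ) (ω : Tape) (K : ℕ) (i : Fin N) : EuclideanSpace ℝ (Fin K) :=
  WithLp.toLp 2 (fun k => leftVectors (subMatrix A S) (startBlock Kmax K S ω) q i k)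

/-! ### `K`-means clustering (labels are `0, …, K - 1`) -/

/-- Index of the centre nearest to `x` (the smallest such index). -/
noncomputable def nearest {E : Type} [PseudoMetricSpace E] (K : ℕ) (c : ℕ → E) (x : E) : ℕ :=
  sInf {k | k < K ∧ ∀ l < K, dist x (c k) ≤ dist x (c l)}

/-- Lloyd iteration: the centres after `T` rounds.  A round assigns every point to its nearest
centre and moves every centre to the mean of its points; a centre without points stays. -/
noncomputable def lloyd {N : ℕ} {E : Type} [NormedAddCommGroup E] [NormedSpace ℝ E] (K : ℕ)
    (p : Fin N → E) (c : ℕ → E) : ℕ → ℕ → E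
  | 0 => c
  | T + 1 => fun k =>
      let cluster := Finset.univ.filter (fun i => nearest K (lloyd K p c T) (p i) = k)
      if cluster.card = 0 then lloyd K p c T k
      else (cluster.card : ℝ)⁻¹ • ∑ i ∈ cluster, p i

/-- Starting centres: centre `k` is the point with the `k`-th smallest index among the points with
index in `R` (the sum has exactly one term when `k < R.card`). -/
noncomputable def startCentres {N : ℕ} {E : Type} [AddCommMonoid E] (p : Fin N → E)
    (R : Finset (Fin N)) (k : ℕ) : E :=
  ∑ i ∈ R.filter (fun i => position R i = k), p i

/-- `K`-means labels after `T` Lloyd rounds. -/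
noncomputable def kmeans {N : ℕ} {E : Type} [NormedAddCommGroup E] [NormedSpace ℝ E] (K T : ℕ)
    (p : Fin N → E) (R : Finset (Fin N)) (i : Fin N) : ℕ :=
  nearest K (lloyd K p (startCentres p R) T) (p i)

/-- Indices of the starting centres for the candidate `K`: a simple random sample of `K` nodes,
obtained from its own `N` draws. -/
noncomputable def startIndices (N n Kmax K : ℕ) (ω : Tape) : Finset (Fin N) :=
  sample N K (fun i => (ω (N + n * Kmax + (K - 1) * N + i) : ℝ))

/-! ### Plug-in estimators and the criterion -/

/-- The pairs `k ≤ l` of labels. -/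
def labelPairs (K : ℕ) : Finset (ℕ × ℕ) :=
  (Finset.range K ×ˢ Finset.range K).filter (fun p => p.1 ≤ p.2)

/-- Node pairs of the subsample that join the communities `k` and `l`. -/
def pairsBetween {N : ℕ} (S : Finset (Fin N)) (g : Fin N → ℕ) (k l : ℕ) :
    Finset (Fin N × Fin N) :=
  (pairs S).filter (fun e => (g e.1 = k ∧ g e.2 = l) ∨ (g e.1 = l ∧ g e.2 = k))

/-- Number of observed connections between the communities `k` and `l`. -/
noncomputable def edgeCount {N : ℕ} (A : Matrix (Fin N) (Fin N) ℝ) (S : Finset (Fin N))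
    (g : Fin N → ℕ) (k l : ℕ) : ℝ :=
  ∑ e ∈ pairsBetween S g k l, A e.1 e.2

/-- Number of possible connections between `k` and `l`, each weighted with `ψ i * ψ j`. -/
noncomputable def pairWeight {N : ℕ} (S : Finset (Fin N)) (g : Fin N → ℕ) (ψ : Fin N → ℝ)
    (k l : ℕ) : ℝ :=
  ∑ e ∈ pairsBetween S g k l, ψ e.1 * ψ e.2

/-- Number of possible connections between the communities `k` and `l`. -/
noncomputable def pairCount {N : ℕ} (S : Finset (Fin N)) (g : Fin N → ℕ) (k l : ℕ) : ℝ :=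
  ((pairsBetween S g k l).card : ℝ)

/-- Log-likelihood of the subsampled matrix under the stochastic block model. -/
noncomputable def logLikSBM {N : ℕ} (A : Matrix (Fin N) (Fin N) ℝ) (S : Finset (Fin N)) (K : ℕ)
    (g : Fin N → ℕ) (B : ℕ → ℕ → ℝ) : ℝ :=
  ∑ p ∈ labelPairs K,
    (edgeCount A S g p.1 p.2 * Real.log (B p.1 p.2)
      + (pairCount S g p.1 p.2 - edgeCount A S g p.1 p.2) * Real.log (1 - B p.1 p.2))

/-- (Poisson) log-likelihood of the subsampled matrix under the degree-corrected model. -/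
noncomputable def logLikDCSBM {N : ℕ} (A : Matrix (Fin N) (Fin N) ℝ) (S : Finset (Fin N)) (K : ℕ)
    (g : Fin N → ℕ) (B : ℕ → ℕ → ℝ) (ψ : Fin N → ℝ) : ℝ :=
  (∑ e ∈ pairs S, A e.1 e.2 * Real.log (ψ e.1 * ψ e.2))
    + ∑ p ∈ labelPairs K,
        (edgeCount A S g p.1 p.2 * Real.log (B p.1 p.2)
          - pairWeight S g ψ p.1 p.2 * B p.1 p.2)

/-- The penalty `n log K + K (K + 1) / 4 * log M` with `M = N n - n (n + 1) / 2`. -/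
noncomputable def penalty (N n K : ℕ) : ℝ :=
  (n : ℝ) * Real.log K
    + (K : ℝ) * (K + 1) / 4 * Real.log ((N : ℝ) * n - (n : ℝ) * (n + 1) / 2)

/-- The two network models. -/
inductive Model : Type
  | sbm
  | dcsbm

/-- The SM-BIC value of the candidate `K`.  Stochastic block model: labels by `K`-means on the
rows of the embedding, plug-in connectivity matrix, penalised log-likelihood.  Degree-corrected
model: labels by `K`-means on the normalised rows (spherical spectral clustering), degree parameters
estimated by the norms of the rows, plug-in connectivity matrix, penalised log-likelihood. -/
noncomputable def criterion {N : ℕ} (A : Matrix (Fin N) (Fin N) ℝ) (n Kmax q T : ℕ) (ω : Tape) :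
    Model → ℕ → ℝ
  | .sbm, K =>
      let S := selectedNodes N n ω
      let v := embedding A S Kmax q ω K
      let g := kmeans K T v (startIndices N n Kmax K ω)
      let B := fun k l => edgeCount A S g k l / pairCount S g k l
      logLikSBM A S K g B - penalty N n K
  | .dcsbm, K =>
      let S := selectedNodes N n ω
      let v := embedding A S Kmax q ω K
      let g := kmeans K T (fun i => ‖v i‖⁻¹ • v i) (startIndices N n Kmax K ω)
      let ψ := fun i => ‖v i‖
      let B := fun k l => edgeCount A S g k l / pairWeight S g ψ k l
      logLikDCSBM A S K g B ψ - penalty N n K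

end SMBIC

-- The two halves are proved independently.
--
-- Sampling. Once the outcome `U` is prescribed, the running counts are those of `U`, so the event
-- that `U` is selected says, separately for each `i < N`, on which side of a fixed threshold draw
-- `i` lies (`sample_eq_iff`). Independence gives a product with factor (n - c) / (N - i) for a
-- member and the complementary factor for a non-member, where c counts the elements of `U` before
-- `i`. The product telescopes through binomial coefficients (`prod_selection`).
--
-- Running time. The program is written in a structured language whose loops and sums are all
-- bounded by input registers that the code cannot change. Hence its meaning is a total function
-- (`Stmt.exec`) and its step count has a bound read off the syntax (`Stmt.cost`); `Stmt.halts`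
-- transfers both to the machine. The bound is a polynomial in the inputs whose degrees in N and n
-- are at most the nesting depths of loops over N and over n (`Stmt.cost_le`). Both depths are 1
-- (`bicStmt_deg`), so the constant is the cost at N = n = 1 plus a few instructions.
--
-- The depth stays 1 for these reasons. The iteration multiplies as A (Aᵀ V). Gram–Schmidt
-- coefficients and column norms are stored before any column is rewritten. The selected nodes are
-- listed, so that node pairs are visited as (node, position in the list) (`eval_sum_pairs`). Loops
-- over the candidates' range cost only a constant, so minimisers are found by brute-force nested
-- sums (`count_eq_sInf`). One decomposition with all columns serves every candidate, because
-- Gram–Schmidt column k depends only on columns up to k and the candidates share one starting block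
-- (`leftVectors_castLE`).
--
-- Correctness is then a comparison of each statement with the definition it implements:
-- `exec_prepareStmt` for the shared data, `exec_candidateStmt` for one candidate, `exec_bicStmt`
-- for the maximisation.

namespace SMBIC

/-! ### A high-level language compiled to the machine -/

/-- The part of the memory that high-level code refers to: five inputs and a sixth constant
register, the arrays, and the number of draws made. -/
@[ext] structure Store where
  inp : Fin 6 → ℕ
  iarr : ℕ → ℕ → ℕ
  varr : ℕ → ℕ → ℕ → ℝ
  draws : ℕ

/-- The store held in a memory. -/
def Memory.store (m : Memory) : Store := ⟨fun r => m.idx r, m.iarr, m.varr, m.draws⟩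

/-- Binary operations on reals. -/
inductive RealOp : Type
  | add
  | sub
  | mul
  | div

/-- Unary operations on reals. -/
inductive RealFn : Type
  | sqrt
  | log

noncomputable def RealOp.fn : RealOp → ℝ → ℝ → ℝ
  | .add => (· + ·)
  | .sub => (· - ·)
  | .mul => (· * ·)
  | .div => (· / ·)

noncomputable def RealFn.fn : RealFn → ℝ → ℝ
  | .sqrt => Real.sqrt
  | .log => Real.log

def RealOp.instr (x y z : ℕ) : RealOp → Instr
  | .add => .vadd x y z
  | .sub => .vsub x y z
  | .mul => .vmul x y z
  | .div => .vdiv x y z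

def RealFn.instr (x y : ℕ) : RealFn → Instr
  | .sqrt => .vsqrt x y
  | .log => .vlog x y

mutual

/-- Expressions with natural-number values; loop variables are de Bruijn indices, truth values are
`0` and `1`, and sums run up to the value of an input register. -/
inductive IExp : Type
  | inp (r : Fin 6)
  | var (k : ℕ)
  | const (c : ℕ)
  | add (a b : IExp)
  | sub (a b : IExp)
  | get (a : ℕ) (i : IExp)
  | lt (a b : IExp)
  | rlt (x y : RExp)
  | ite (c a b : IExp)
  | sum (b : Fin 6) (e : IExp)

/-- Expressions with real values. -/
inductive RExp : Type
  | cast (a : IExp)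
  | bin (o : RealOp) (x y : RExp)
  | un (o : RealFn) (x : RExp)
  | get (a : ℕ) (i j : IExp)
  | ite (c : IExp) (x y : RExp)
  | sum (b : Fin 6) (e : RExp)

end

mutual

/-- Value of an expression in an environment of loop variables. -/
noncomputable def IExp.eval : IExp → List ℕ → Store → ℕ
  | .inp r, _, σ => σ.inp r
  | .var k, ρ, _ => (ρ[k]?).getD 0
  | .const c, _, _ => c
  | .add a b, ρ, σ => a.eval ρ σ + b.eval ρ σ
  | .sub a b, ρ, σ => a.eval ρ σ - b.eval ρ σ
  | .get a i, ρ, σ => σ.iarr a (i.eval ρ σ)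
  | .lt a b, ρ, σ => if a.eval ρ σ < b.eval ρ σ then 1 else 0
  | .rlt x y, ρ, σ => if x.eval ρ σ < y.eval ρ σ then 1 else 0
  | .ite c a b, ρ, σ => if 0 < c.eval ρ σ then a.eval ρ σ else b.eval ρ σ
  | .sum b e, ρ, σ => ∑ i ∈ Finset.range (σ.inp b), e.eval (i :: ρ) σ

/-- Value of an expression in an environment of loop variables. -/
noncomputable def RExp.eval : RExp → List ℕ → Store → ℝ
  | .cast a, ρ, σ => (a.eval ρ σ : ℝ)
  | .bin o x y, ρ, σ => o.fn (x.eval ρ σ) (y.eval ρ σ)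
  | .un o x, ρ, σ => o.fn (x.eval ρ σ)
  | .get a i j, ρ, σ => σ.varr a (i.eval ρ σ) (j.eval ρ σ)
  | .ite c x y, ρ, σ => if 0 < c.eval ρ σ then x.eval ρ σ else y.eval ρ σ
  | .sum b e, ρ, σ => ∑ i ∈ Finset.range (σ.inp b), e.eval (i :: ρ) σ

end

mutual

/-- Code that leaves the value of the expression in register `d` and uses no register below `d`
for intermediate results; `regs` lists the registers of the loop variables. -/
def IExp.comp : IExp → ℕ → List ℕ → Program
  | .inp r, d, _ => .seq (.act (.iconst d 0)) (.act (.iadd d r d))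
  | .var k, d, regs =>
      match regs[k]? with
      | some r => .seq (.act (.iconst d 0)) (.act (.iadd d r d))
      | none => .act (.iconst d 0)
  | .const c, d, _ => .act (.iconst d c)
  | .add a b, d, regs => .seq (a.comp d regs) (.seq (b.comp (d + 1) regs) (.act (.iadd d d (d + 1))))
  | .sub a b, d, regs => .seq (a.comp d regs) (.seq (b.comp (d + 1) regs) (.act (.isub d d (d + 1))))
  | .get a i, d, regs => .seq (i.comp d regs) (.act (.iload d a d))
  | .lt a b, d, regs => .seq (a.comp d regs) (.seq (b.comp (d + 1) regs)
      (.branch (.ilt d (d + 1)) (.act (.iconst d 1)) (.act (.iconst d 0))))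
  | .rlt x y, d, regs => .seq (x.comp d regs) (.seq (y.comp (d + 1) regs)
      (.branch (.vlt d (d + 1)) (.act (.iconst d 1)) (.act (.iconst d 0))))
  | .ite c a b, d, regs => .seq (c.comp d regs) (.seq (.act (.iconst (d + 1) 0))
      (.branch (.ilt (d + 1) d) (a.comp d regs) (b.comp d regs)))
  | .sum b e, d, regs => .seq (.act (.iconst d 0)) (.seq (.act (.iconst (d + 1) 0))
      (.loop (.ilt (d + 1) b) (.seq (e.comp (d + 2) ((d + 1) :: regs))
        (.seq (.act (.iadd d d (d + 2)))
          (.seq (.act (.iconst (d + 2) 1)) (.act (.iadd (d + 1) (d + 1) (d + 2))))))))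

/-- Code that leaves the value of the expression in real register `d`. -/
def RExp.comp : RExp → ℕ → List ℕ → Program
  | .cast a, d, regs => .seq (a.comp d regs) (.act (.ofIdx d d))
  | .bin o x y, d, regs =>
      .seq (x.comp d regs) (.seq (y.comp (d + 1) regs) (.act (o.instr d d (d + 1))))
  | .un o x, d, regs => .seq (x.comp d regs) (.act (o.instr d d))
  | .get a i j, d, regs =>
      .seq (i.comp d regs) (.seq (j.comp (d + 1) regs) (.act (.vload d a d (d + 1))))
  | .ite c x y, d, regs => .seq (c.comp d regs) (.seq (.act (.iconst (d + 1) 0))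
      (.branch (.ilt (d + 1) d) (x.comp d regs) (y.comp d regs)))
  | .sum b e, d, regs => .seq (.act (.iconst (d + 1) 0)) (.seq (.act (.ofIdx d (d + 1)))
      (.loop (.ilt (d + 1) b) (.seq (e.comp (d + 2) ((d + 1) :: regs))
        (.seq (.act (.vadd d d (d + 2)))
          (.seq (.act (.iconst (d + 2) 1)) (.act (.iadd (d + 1) (d + 1) (d + 2))))))))

end

mutual

/-- Bound for the number of steps of the compiled expression. -/
def IExp.cost : IExp → (Fin 6 → ℕ) → ℕ
  | .inp _, _ => 2
  | .var _, _ => 2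
  | .const _, _ => 1
  | .add a b, β => a.cost β + b.cost β + 1
  | .sub a b, β => a.cost β + b.cost β + 1
  | .get _ i, β => i.cost β + 1
  | .lt a b, β => a.cost β + b.cost β + 2
  | .rlt x y, β => x.cost β + y.cost β + 2
  | .ite c a b, β => c.cost β + a.cost β + b.cost β + 2
  | .sum b e, β => β b * (e.cost β + 4) + 3

/-- Bound for the number of steps of the compiled expression. -/
def RExp.cost : RExp → (Fin 6 → ℕ) → ℕ
  | .cast a, β => a.cost β + 1
  | .bin _ x y, β => x.cost β + y.cost β + 1
  | .un _ x, β => x.cost β + 1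
  | .get _ i j, β => i.cost β + j.cost β + 1
  | .ite c x y, β => c.cost β + x.cost β + y.cost β + 2
  | .sum b e, β => β b * (e.cost β + 4) + 3

end

/-- `p` halts from `m` within `T` steps in a memory with property `Q`. -/
def Halts (ω : Tape) (p : Program) (m : Memory) (T : ℕ) (Q : Memory → Prop) : Prop :=
  ∃ t m', Run ω p m t m' ∧ t ≤ T ∧ Q m'

-- Rules for termination within a step bound.

section Halts

variable {ω : Tape} {p q : Program} {m : Memory} {T T₁ T₂ : ℕ} {Q Q₁ : Memory → Prop} {b : Test}

theorem Halts.mono (h : Halts ω p m T₁ Q₁) (hT : T₁ ≤ T) (hQ : ∀ m', Q₁ m' → Q m') :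
    Halts ω p m T Q :=
  let ⟨t, m', hr, ht, hm⟩ := h
  ⟨t, m', hr, ht.trans hT, hQ _ hm⟩

theorem Halts.act {i : Instr} (h : Q (i.step ω m)) : Halts ω (.act i) m 1 Q :=
  ⟨1, _, .act i m, le_rfl, h⟩

theorem Halts.seq (hp : Halts ω p m T₁ Q₁) (hq : ∀ m', Q₁ m' → Halts ω q m' T₂ Q)
    (hT : T₁ + T₂ ≤ T) : Halts ω (.seq p q) m T Q :=
  let ⟨_, m₁, hr, ht, hm⟩ := hp
  let ⟨_, m₂, hr', ht', hm'⟩ := hq m₁ hm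
  ⟨_, m₂, .seq hr hr', (add_le_add ht ht').trans hT, hm'⟩

theorem Halts.act_seq {i : Instr} (hq : Halts ω q (i.step ω m) T₂ Q) (hT : 1 + T₂ ≤ T) :
    Halts ω (.seq (.act i) q) m T Q :=
  Halts.seq (Q₁ := fun m' => m' = i.step ω m) (.act rfl) (fun _ h => h ▸ hq) hT

theorem Halts.branch (hp : b.Holds m → Halts ω p m T₁ Q) (hq : ¬ b.Holds m → Halts ω q m T₁ Q)
    (hT : 1 + T₁ ≤ T) : Halts ω (.branch b p q) m T Q := by
  by_cases h : b.Holds m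
  · obtain ⟨t, m', hr, ht, hm⟩ := hp h
    exact ⟨_, m', .branchTrue h hr, by omega, hm⟩
  · obtain ⟨t, m', hr, ht, hm⟩ := hq h
    exact ⟨_, m', .branchFalse h hr, by omega, hm⟩

/-- Counting loops. -/
theorem Halts.count {r s B : ℕ} {I : ℕ → Memory → Prop} (hI : ∀ i m, I i m → m.idx r = i)
    (hs : ∀ i m, I i m → m.idx s = B)
    (hp : ∀ i m, i < B → I i m → Halts ω p m T₁ (I (i + 1))) (h₀ : I 0 m) :
    Halts ω (.loop (.ilt r s) p) m (B * (T₁ + 1) + 1) (I B) := by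
  -- Induction on the number `k` of rounds left. Each round costs one test more than its body, and
  -- the final `+ 1` is the failing test.
  suffices H : ∀ k i m, i + k = B → I i m →
      Halts ω (.loop (.ilt r s) p) m (k * (T₁ + 1) + 1) (I B) from H B 0 m (by omega) h₀
  intro k
  induction k with
  | zero =>
    intro i m hi hm
    obtain rfl : i = B := by omega
    refine ⟨1, m, .loopFalse ?_, by omega, hm⟩
    simp [Test.Holds, hI _ _ hm, hs _ _ hm]
  | succ k ih =>
    intro i m hi hm
    obtain ⟨t, m', hr, ht, hm'⟩ := hp i m (by omega) hm
    obtain ⟨t', m'', hr', ht', hm''⟩ := ih (i + 1) m' (by omega) hm'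
    refine ⟨_, m'', .loopTrue ?_ hr hr', ?_, hm''⟩
    · simp only [Test.Holds, hI _ _ hm, hs _ _ hm]; omega
    · rw [add_mul]; omega

end Halts

/-- `m'` differs from `m` at most in registers from `d` on. -/
structure Agree (d : ℕ) (m m' : Memory) : Prop where
  idx : ∀ r < d, m'.idx r = m.idx r
  val : ∀ r < d, m'.val r = m.val r
  iarr : m'.iarr = m.iarr
  varr : m'.varr = m.varr
  draws : m'.draws = m.draws

theorem Agree.refl (d : ℕ) (m : Memory) : Agree d m m :=
  ⟨fun _ _ => rfl, fun _ _ => rfl, rfl, rfl, rfl⟩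

theorem Agree.trans {d d' : ℕ} {m m' m'' : Memory} (h : Agree d m m') (h' : Agree d' m' m'')
    (hd : d ≤ d') : Agree d m m'' :=
  ⟨fun r hr => (h'.idx r (hr.trans_le hd)).trans (h.idx r hr),
    fun r hr => (h'.val r (hr.trans_le hd)).trans (h.val r hr),
    h'.iarr.trans h.iarr, h'.varr.trans h.varr, h'.draws.trans h.draws⟩

theorem Agree.setIdx {d : ℕ} {m m' : Memory} (h : Agree d m m') {r : ℕ} (hr : d ≤ r) (v : ℕ) :
    Agree d m (m'.setIdx r v) :=
  ⟨fun s hs => by simp [Memory.setIdx, (hs.trans_le hr).ne, h.idx s hs], h.val, h.iarr, h.varr,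
    h.draws⟩

theorem Agree.setVal {d : ℕ} {m m' : Memory} (h : Agree d m m') {r : ℕ} (hr : d ≤ r) (v : ℝ) :
    Agree d m (m'.setVal r v) :=
  ⟨h.idx, fun s hs => by simp [Memory.setVal, (hs.trans_le hr).ne, h.val s hs], h.iarr, h.varr,
    h.draws⟩

/-- The memory `m` represents the store `σ` and the environment `ρ`, with the loop variables in the
registers `regs` and all registers from `d` on free. -/
structure Rep (d : ℕ) (regs : List ℕ) (ρ : List ℕ) (σ : Store) (m : Memory) : Prop where
  six_le : 6 ≤ d
  lt : ∀ r ∈ regs, r < d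
  env : regs.map m.idx = ρ
  store : m.store = σ

section Rep

variable {d : ℕ} {regs ρ : List ℕ} {σ : Store} {m m' : Memory}

theorem Rep.agree (h : Rep d regs ρ σ m) (h' : Agree d m m') : Rep d regs ρ σ m' := by
  refine ⟨h.six_le, h.lt, ?_, ?_⟩
  · rw [← h.env]
    exact List.map_congr_left fun r hr => h'.idx r (h.lt r hr)
  · rw [← h.store]
    have := h.six_le
    ext1
    · funext r; exact h'.idx r (by omega)
    · exact h'.iarr
    · exact h'.varr
    · exact h'.draws

theorem Rep.mono (h : Rep d regs ρ σ m) {d' : ℕ} (hd : d ≤ d') : Rep d' regs ρ σ m :=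
  ⟨h.six_le.trans hd, fun r hr => (h.lt r hr).trans_le hd, h.env, h.store⟩

theorem Rep.cons (h : Rep d regs ρ σ m) {d' r i : ℕ} (hd : d ≤ d') (hr : r < d')
    (hi : m.idx r = i) : Rep d' (r :: regs) (i :: ρ) σ m := by
  refine ⟨h.six_le.trans hd, ?_, by simp [h.env, hi], h.store⟩
  intro s hs
  rcases List.mem_cons.1 hs with rfl | hs
  exacts [hr, (h.lt s hs).trans_le hd]

theorem Rep.inp (h : Rep d regs ρ σ m) (b : Fin 6) : m.idx b = σ.inp b := by
  rw [← h.store]; rfl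

theorem Rep.iarr (h : Rep d regs ρ σ m) : m.iarr = σ.iarr := by
  rw [← h.store]; rfl

theorem Rep.varr (h : Rep d regs ρ σ m) : m.varr = σ.varr := by
  rw [← h.store]; rfl

end Rep

@[simp] theorem Memory.setIdx_idx (m : Memory) (r v : ℕ) :
    (m.setIdx r v).idx = Function.update m.idx r v := rfl
@[simp] theorem Memory.setIdx_val (m : Memory) (r v : ℕ) : (m.setIdx r v).val = m.val := rfl
@[simp] theorem Memory.setIdx_varr (m : Memory) (r v : ℕ) : (m.setIdx r v).varr = m.varr := rfl
@[simp] theorem Memory.setIdx_iarr (m : Memory) (r v : ℕ) : (m.setIdx r v).iarr = m.iarr := rfl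
@[simp] theorem Memory.setVal_idx (m : Memory) (r : ℕ) (v : ℝ) : (m.setVal r v).idx = m.idx := rfl
@[simp] theorem Memory.setVal_val (m : Memory) (r : ℕ) (v : ℝ) :
    (m.setVal r v).val = Function.update m.val r v := rfl
@[simp] theorem Memory.setVal_varr (m : Memory) (r : ℕ) (v : ℝ) :
    (m.setVal r v).varr = m.varr := rfl
@[simp] theorem Memory.setVal_iarr (m : Memory) (r : ℕ) (v : ℝ) :
    (m.setVal r v).iarr = m.iarr := rfl

theorem RealOp.step_instr (o : RealOp) (ω : Tape) (m : Memory) (x y z : ℕ) :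
    (o.instr x y z).step ω m = m.setVal x (o.fn (m.val y) (m.val z)) := by
  cases o <;> rfl

theorem RealFn.step_instr (o : RealFn) (ω : Tape) (m : Memory) (x y : ℕ) :
    (o.instr x y).step ω m = m.setVal x (o.fn (m.val y)) := by
  cases o <;> rfl

/-- The machine has no move instruction, so copying is addition of zero; `r < d` ensures that
clearing `d` does not destroy the source. -/
theorem halts_copy {ω : Tape} {d r : ℕ} {m : Memory} (hr : r < d) :
    Halts ω (.seq (.act (.iconst d 0)) (.act (.iadd d r d))) m 2
      (fun m' => m'.idx d = m.idx r ∧ Agree d m m') := by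
  refine .act_seq (.act ⟨?_, ?_⟩) le_rfl
  · simp [Instr.step, hr.ne]
  · exact ((Agree.refl d m).setIdx le_rfl _).setIdx le_rfl _

/-- The branch that stores the truth value of a test. -/
theorem halts_truth {ω : Tape} {d : ℕ} {m : Memory} {b : Test} {P : Prop} [Decidable P]
    (hb : b.Holds m ↔ P) :
    Halts ω (.branch b (.act (.iconst d 1)) (.act (.iconst d 0))) m 2
      (fun m' => m'.idx d = (if P then 1 else 0) ∧ Agree d m m') := by
  refine .branch (fun h => .act ⟨?_, (Agree.refl d m).setIdx le_rfl _⟩)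
    (fun h => .act ⟨?_, (Agree.refl d m).setIdx le_rfl _⟩) le_rfl
  · simp [Instr.step, hb.1 h]
  · simp [Instr.step, mt hb.2 h]

/-- The end of the body of the loop for a sum: the loop variable is increased. -/
theorem halts_incr {ω : Tape} {d r : ℕ} {m : Memory} (hr : r < d) :
    Halts ω (.seq (.act (.iconst d 1)) (.act (.iadd r r d))) m 2
      (fun m' => m' = (m.setIdx d 1).setIdx r (m.idx r + 1)) := by
  refine .act_seq (.act ?_) le_rfl
  simp [Instr.step, hr.ne]

-- Correctness and cost of compiled expressions.

mutual

theorem IExp.halts (ω : Tape) : ∀ (e : IExp) {d : ℕ} {regs ρ : List ℕ} {σ : Store} {m : Memory},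
    Rep d regs ρ σ m → Halts ω (e.comp d regs) m (e.cost σ.inp)
      (fun m' => m'.idx d = e.eval ρ σ ∧ Agree d m m')
  | .inp r, d, regs, ρ, σ, m, h => by
    have := h.six_le
    have h' := halts_copy (ω := ω) (m := m) (d := d) (r := r) (by omega)
    rw [h.inp] at h'
    simpa only [IExp.comp, IExp.cost, IExp.eval] using h'
  | .var k, d, regs, ρ, σ, m, h => by
    rcases hk : regs[k]? with _ | r
    · simp only [IExp.comp, IExp.cost, IExp.eval, hk]
      refine Halts.mono (.act ⟨?_, (Agree.refl d m).setIdx le_rfl _⟩) one_le_two fun m' h => h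
      simp [Instr.step, ← h.env, hk]
    · have h' := halts_copy (ω := ω) (m := m) (h.lt r (List.mem_of_getElem? hk))
      simp only [IExp.comp, IExp.cost, IExp.eval, hk]
      simpa [← h.env, hk] using h'
  | .const c, d, regs, ρ, σ, m, h => by
    refine .act ⟨?_, (Agree.refl d m).setIdx le_rfl _⟩
    simp [Instr.step, IExp.eval]
  | .add a b, d, regs, ρ, σ, m, h => by
    refine .seq (a.halts ω h) (fun m₁ ⟨h₁, g₁⟩ => .seq (T := b.cost σ.inp + 1)
      (b.halts ω ((h.agree g₁).mono (Nat.le_succ d)))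
      (fun m₂ ⟨h₂, g₂⟩ => .act ⟨?_, ((g₁.trans g₂ (Nat.le_succ d))).setIdx le_rfl _⟩) le_rfl)
      (by simp only [IExp.cost]; omega)
    simp [Instr.step, IExp.eval, h₂, g₂.idx d (Nat.lt_succ_self d), h₁]
  | .sub a b, d, regs, ρ, σ, m, h => by
    refine .seq (a.halts ω h) (fun m₁ ⟨h₁, g₁⟩ => .seq (T := b.cost σ.inp + 1)
      (b.halts ω ((h.agree g₁).mono (Nat.le_succ d)))
      (fun m₂ ⟨h₂, g₂⟩ => .act ⟨?_, ((g₁.trans g₂ (Nat.le_succ d))).setIdx le_rfl _⟩) le_rfl)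
      (by simp only [IExp.cost]; omega)
    simp [Instr.step, IExp.eval, h₂, g₂.idx d (Nat.lt_succ_self d), h₁]
  | .get a i, d, regs, ρ, σ, m, h => by
    refine .seq (i.halts ω h) (fun m₁ ⟨h₁, g₁⟩ => .act ⟨?_, g₁.setIdx le_rfl _⟩)
      (by simp only [IExp.cost]; omega)
    simp [Instr.step, IExp.eval, h₁, (h.agree g₁).iarr]
  | .lt a b, d, regs, ρ, σ, m, h => by
    refine .seq (a.halts ω h) (fun m₁ ⟨h₁, g₁⟩ => .seq (T := b.cost σ.inp + 2)
      (b.halts ω ((h.agree g₁).mono (Nat.le_succ d)))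
      (fun m₂ ⟨h₂, g₂⟩ => (halts_truth (P := a.eval ρ σ < b.eval ρ σ) ?_).mono le_rfl
        fun m' ⟨h', g'⟩ => ⟨?_, (g₁.trans g₂ (Nat.le_succ d)).trans g' le_rfl⟩) le_rfl)
      (by simp only [IExp.cost]; omega)
    · simp [Test.Holds, h₂, g₂.idx d (Nat.lt_succ_self d), h₁]
    · simpa only [IExp.eval] using h'
  | .rlt x y, d, regs, ρ, σ, m, h => by
    classical
    refine .seq (x.halts ω h) (fun m₁ ⟨h₁, g₁⟩ => .seq (T := y.cost σ.inp + 2)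
      (y.halts ω ((h.agree g₁).mono (Nat.le_succ d)))
      (fun m₂ ⟨h₂, g₂⟩ => (halts_truth (P := x.eval ρ σ < y.eval ρ σ) ?_).mono le_rfl
        fun m' ⟨h', g'⟩ => ⟨?_, (g₁.trans g₂ (Nat.le_succ d)).trans g' le_rfl⟩) le_rfl)
      (by simp only [IExp.cost]; omega)
    · simp [Test.Holds, h₂, g₂.val d (Nat.lt_succ_self d), h₁]
    · simp only [IExp.eval]; convert h'
  | .ite c a b, d, regs, ρ, σ, m, h => by
    refine .seq (c.halts ω h) (fun m₁ ⟨h₁, g₁⟩ => .act_seq (T := a.cost σ.inp + b.cost σ.inp + 2)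
      (.branch (T₁ := a.cost σ.inp + b.cost σ.inp) (fun hc => ?_) (fun hc => ?_) le_rfl) (by omega))
      (by simp only [IExp.cost]; omega)
    all_goals
      have g₂ : Agree d m (Instr.step ω m₁ (.iconst (d + 1) 0)) := g₁.setIdx (Nat.le_succ d) _
      simp only [Test.Holds, Instr.step, Memory.setIdx_idx, Function.update_self, ne_eq,
        not_false_eq_true, Function.update_of_ne, h₁, (Nat.succ_ne_self d).symm]
        at hc
    · refine (a.halts ω (h.agree g₂)).mono (by omega) fun m' ⟨h', g'⟩ => ⟨?_, g₂.trans g' le_rfl⟩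
      simp [IExp.eval, hc, h']
    · refine (b.halts ω (h.agree g₂)).mono (by omega) fun m' ⟨h', g'⟩ => ⟨?_, g₂.trans g' le_rfl⟩
      simp [IExp.eval, hc, h']
  | .sum b e, d, regs, ρ, σ, m, h => by
    have h6 := h.six_le
    simp only [IExp.comp, IExp.cost, IExp.eval]
    refine .act_seq (.act_seq (T := σ.inp b * (e.cost σ.inp + 4) + 2)
      -- Loop invariant: `d + 1` holds the counter and `d` the partial sum. The body works from `d +
      -- 2` on, with the counter pushed onto the environment.
      (T₂ := σ.inp b * (e.cost σ.inp + 4) + 1) (Halts.mono (Halts.count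
      (B := σ.inp b) (T₁ := e.cost σ.inp + 3)
      (I := fun i m' => m'.idx (d + 1) = i ∧
        m'.idx d = ∑ j ∈ Finset.range i, e.eval (j :: ρ) σ ∧ Agree d m m')
      (fun i m' h => h.1) (fun i m' h' => (h.agree h'.2.2).inp b) ?_ ?_) le_rfl
      (fun m' h => h.2)) (by omega)) (by omega)
    · rintro i m₁ hi ⟨h₁, h₂, g⟩
      refine .seq (e.halts ω ((h.agree g).cons (d' := d + 2) (by omega) (by omega) h₁))
        (fun m₂ ⟨k₁, g₁⟩ => .act_seq (T := 3) ((halts_incr (by omega)).mono le_rfl ?_) le_rfl) le_rfl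
      rintro m' rfl
      refine ⟨?_, ?_, ?_⟩
      · simp [Instr.step, g₁.idx, h₁]
      · simp [Instr.step, g₁.idx, k₁, h₂, Finset.sum_range_succ]
      · exact (((g.trans g₁ (by omega)).setIdx le_rfl _).setIdx (by omega) _).setIdx (by omega) _
    · refine ⟨by simp [Instr.step], by simp [Instr.step], ?_⟩
      exact ((Agree.refl d m).setIdx le_rfl _).setIdx (by omega) _

theorem RExp.halts (ω : Tape) : ∀ (e : RExp) {d : ℕ} {regs ρ : List ℕ} {σ : Store} {m : Memory},
    Rep d regs ρ σ m → Halts ω (e.comp d regs) m (e.cost σ.inp)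
      (fun m' => m'.val d = e.eval ρ σ ∧ Agree d m m')
  | .cast a, d, regs, ρ, σ, m, h => by
    refine .seq (a.halts ω h) (fun m₁ ⟨h₁, g₁⟩ => .act ⟨?_, g₁.setVal le_rfl _⟩) le_rfl
    simp [Instr.step, RExp.eval, h₁]
  | .bin o x y, d, regs, ρ, σ, m, h => by
    refine .seq (x.halts ω h) (fun m₁ ⟨h₁, g₁⟩ => .seq (T := y.cost σ.inp + 1)
      (y.halts ω ((h.agree g₁).mono (Nat.le_succ d)))
      (fun m₂ ⟨h₂, g₂⟩ => .act ?_) le_rfl)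
      (by simp only [RExp.cost]; omega)
    rw [RealOp.step_instr]
    refine ⟨?_, ((g₁.trans g₂ (Nat.le_succ d))).setVal le_rfl _⟩
    simp [RExp.eval, h₂, g₂.val d (Nat.lt_succ_self d), h₁]
  | .un o x, d, regs, ρ, σ, m, h => by
    refine .seq (x.halts ω h) (fun m₁ ⟨h₁, g₁⟩ => .act ?_) le_rfl
    rw [RealFn.step_instr]
    exact ⟨by simp [RExp.eval, h₁], g₁.setVal le_rfl _⟩
  | .get a i j, d, regs, ρ, σ, m, h => by
    refine .seq (i.halts ω h) (fun m₁ ⟨h₁, g₁⟩ => .seq (T := j.cost σ.inp + 1)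
      (j.halts ω ((h.agree g₁).mono (Nat.le_succ d)))
      (fun m₂ ⟨h₂, g₂⟩ => .act ⟨?_, ((g₁.trans g₂ (Nat.le_succ d))).setVal le_rfl _⟩) le_rfl)
      (by simp only [RExp.cost]; omega)
    simp [Instr.step, RExp.eval, h₂, g₂.idx d (Nat.lt_succ_self d), h₁,
      (h.agree (g₁.trans g₂ (Nat.le_succ d))).varr]
  | .ite c a b, d, regs, ρ, σ, m, h => by
    refine .seq (c.halts ω h) (fun m₁ ⟨h₁, g₁⟩ => .act_seq (T := a.cost σ.inp + b.cost σ.inp + 2)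
      (.branch (T₁ := a.cost σ.inp + b.cost σ.inp) (fun hc => ?_) (fun hc => ?_) le_rfl) (by omega))
      (by simp only [RExp.cost]; omega)
    all_goals
      have g₂ : Agree d m (Instr.step ω m₁ (.iconst (d + 1) 0)) := g₁.setIdx (Nat.le_succ d) _
      simp only [Test.Holds, Instr.step, Memory.setIdx_idx, Function.update_self, ne_eq,
        not_false_eq_true, Function.update_of_ne, h₁, (Nat.succ_ne_self d).symm]
        at hc
    · refine (a.halts ω (h.agree g₂)).mono (by omega) fun m' ⟨h', g'⟩ => ⟨?_, g₂.trans g' le_rfl⟩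
      simp [RExp.eval, hc, h']
    · refine (b.halts ω (h.agree g₂)).mono (by omega) fun m' ⟨h', g'⟩ => ⟨?_, g₂.trans g' le_rfl⟩
      simp [RExp.eval, hc, h']
  | .sum b e, d, regs, ρ, σ, m, h => by
    have h6 := h.six_le
    simp only [RExp.comp, RExp.cost, RExp.eval]
    refine .act_seq (.act_seq (T := σ.inp b * (e.cost σ.inp + 4) + 2)
      (T₂ := σ.inp b * (e.cost σ.inp + 4) + 1) (Halts.mono (Halts.count
      (B := σ.inp b) (T₁ := e.cost σ.inp + 3)
      (I := fun i m' => m'.idx (d + 1) = i ∧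
        m'.val d = ∑ j ∈ Finset.range i, e.eval (j :: ρ) σ ∧ Agree d m m')
      (fun i m' h => h.1) (fun i m' h' => (h.agree h'.2.2).inp b) ?_ ?_) le_rfl
      (fun m' h => h.2)) (by omega)) (by omega)
    · rintro i m₁ hi ⟨h₁, h₂, g⟩
      refine .seq (e.halts ω ((h.agree g).cons (d' := d + 2) (by omega) (by omega) h₁))
        (fun m₂ ⟨k₁, g₁⟩ => .act_seq (T := 3) ((halts_incr (by omega)).mono le_rfl ?_) le_rfl) le_rfl
      rintro m' rfl
      refine ⟨?_, ?_, ?_⟩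
      · simp [Instr.step, g₁.idx, h₁]
      · simp [Instr.step, g₁.val, k₁, h₂, Finset.sum_range_succ]
      · exact (((g.trans g₁ (by omega)).setVal le_rfl _).setIdx (by omega) _).setIdx (by omega) _
    · refine ⟨by simp [Instr.step], by simp [Instr.step], ?_⟩
      exact ((Agree.refl d m).setIdx (by omega) _).setVal (by omega) _

end

-- Statements and their compilation.

/-- Statements; loops run up to the value of an input register. -/
inductive Stmt : Type
  | setI (a : ℕ) (i e : IExp)
  | setR (a : ℕ) (i j : IExp) (e : RExp)
  | draw (a : ℕ) (i j : IExp)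
  | seq (s t : Stmt)
  | loop (b : Fin 6) (s : Stmt)

def Store.setI (σ : Store) (a i v : ℕ) : Store :=
  { σ with iarr := Function.update σ.iarr a (Function.update (σ.iarr a) i v) }

noncomputable def Store.setR (σ : Store) (a i j : ℕ) (v : ℝ) : Store :=
  { σ with varr := Function.update σ.varr a
             (Function.update (σ.varr a) i (Function.update (σ.varr a i) j v)) }

/-- Iteration of an indexed family of maps. -/
def Store.iter (f : ℕ → Store → Store) (σ : Store) : ℕ → Store
  | 0 => σ
  | k + 1 => f k (Store.iter f σ k)

/-- The effect of a statement. -/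
noncomputable def Stmt.exec (ω : Tape) : Stmt → List ℕ → Store → Store
  | .setI a i e, ρ, σ => σ.setI a (i.eval ρ σ) (e.eval ρ σ)
  | .setR a i j e, ρ, σ => σ.setR a (i.eval ρ σ) (j.eval ρ σ) (e.eval ρ σ)
  | .draw a i j, ρ, σ =>
      { σ.setR a (i.eval ρ σ) (j.eval ρ σ) (ω σ.draws : ℝ) with draws := σ.draws + 1 }
  | .seq s t, ρ, σ => t.exec ω ρ (s.exec ω ρ σ)
  | .loop b s, ρ, σ => Store.iter (fun i τ => s.exec ω (i :: ρ) τ) σ (σ.inp b)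

/-- Code for a statement, using registers from `d` on for intermediate results. -/
def Stmt.comp : Stmt → ℕ → List ℕ → Program
  | .setI a i e, d, regs =>
      .seq (i.comp d regs) (.seq (e.comp (d + 1) regs) (.act (.istore a d (d + 1))))
  | .setR a i j e, d, regs =>
      .seq (i.comp d regs) (.seq (j.comp (d + 1) regs)
        (.seq (e.comp (d + 2) regs) (.act (.vstore a d (d + 1) (d + 2)))))
  | .draw a i j, d, regs =>
      .seq (i.comp d regs) (.seq (j.comp (d + 1) regs)
        (.seq (.act (.draw d)) (.act (.vstore a d (d + 1) d))))
  | .seq s t, d, regs => .seq (s.comp d regs) (t.comp d regs)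
  | .loop b s, d, regs => .seq (.act (.iconst d 0)) (.loop (.ilt d b)
      (.seq (s.comp (d + 1) (d :: regs))
        (.seq (.act (.iconst (d + 1) 1)) (.act (.iadd d d (d + 1))))))

/-- Bound for the number of steps of the compiled statement. -/
def Stmt.cost : Stmt → (Fin 6 → ℕ) → ℕ
  | .setI _ i e, β => i.cost β + e.cost β + 1
  | .setR _ i j e, β => i.cost β + j.cost β + e.cost β + 1
  | .draw _ i j, β => i.cost β + j.cost β + 2
  | .seq s t, β => s.cost β + t.cost β
  | .loop b s, β => β b * (s.cost β + 3) + 2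

theorem Store.iter_inp {f : ℕ → Store → Store} (hf : ∀ i τ, (f i τ).inp = τ.inp) (σ : Store) :
    ∀ k, (Store.iter f σ k).inp = σ.inp
  | 0 => rfl
  | k + 1 => (hf _ _).trans (Store.iter_inp hf σ k)

@[simp] theorem Stmt.exec_inp (ω : Tape) (s : Stmt) :
    ∀ (ρ : List ℕ) (σ : Store), (s.exec ω ρ σ).inp = σ.inp := by
  induction s with
  | setI a i e => intros; rfl
  | setR a i j e => intros; rfl
  | draw a i j => intros; rfl
  | seq s t hs ht => intro ρ σ; simp [Stmt.exec, hs, ht]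
  | loop b s hs =>
    intro ρ σ
    exact Store.iter_inp (f := fun i τ => s.exec ω (i :: ρ) τ) (fun i τ => hs _ _) σ _

/-- Statements change arrays, so `Agree` fails for them. Keeping the index registers below `d` is
enough, since loop variables live only there. -/
theorem Rep.of_idx {d : ℕ} {regs ρ : List ℕ} {σ τ : Store} {m m' : Memory} (h : Rep d regs ρ σ m)
    (hi : ∀ r < d, m'.idx r = m.idx r) (hs : m'.store = τ) : Rep d regs ρ τ m' :=
  ⟨h.six_le, h.lt, by rw [← h.env]; exact List.map_congr_left fun r hr => hi r (h.lt r hr), hs⟩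

/-- Correctness of the compiled code of statements. -/
theorem Stmt.halts (ω : Tape) (s : Stmt) : ∀ {d : ℕ} {regs ρ : List ℕ} {σ : Store} {m : Memory},
    Rep d regs ρ σ m → Halts ω (s.comp d regs) m (s.cost σ.inp)
      (fun m' => (∀ r < d, m'.idx r = m.idx r) ∧ m'.store = s.exec ω ρ σ) := by
  induction s with
  | setI a i e =>
    intro d regs ρ σ m h
    refine .seq (i.halts ω h) (fun m₁ ⟨h₁, g₁⟩ => .seq (T := e.cost σ.inp + 1)
      (e.halts ω ((h.agree g₁).mono (Nat.le_succ d)))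
      (fun m₂ ⟨h₂, g₂⟩ => .act ?_) le_rfl) (by simp only [Stmt.cost]; omega)
    have g := g₁.trans g₂ (Nat.le_succ d)
    refine ⟨fun r hr => g.idx r hr, ?_⟩
    rw [Stmt.exec, ← h₁, ← h₂, ← g₂.idx d (Nat.lt_succ_self d), ← (h.agree g).store]
    rfl
  | setR a i j e =>
    intro d regs ρ σ m h
    refine .seq (i.halts ω h) (fun m₁ ⟨h₁, g₁⟩ => .seq (T := j.cost σ.inp + (e.cost σ.inp + 1))
      (j.halts ω ((h.agree g₁).mono (Nat.le_succ d)))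
      (fun m₂ ⟨h₂, g₂⟩ => .seq (T := e.cost σ.inp + 1)
        (e.halts ω (((h.agree g₁).mono (Nat.le_succ d)).agree g₂ |>.mono (Nat.le_succ (d + 1))))
        (fun m₃ ⟨h₃, g₃⟩ => .act ?_) le_rfl) le_rfl) (by simp only [Stmt.cost]; omega)
    have g := (g₁.trans g₂ (Nat.le_succ d)).trans g₃ (by omega)
    refine ⟨fun r hr => g.idx r hr, ?_⟩
    rw [Stmt.exec, ← h₁, ← h₂, ← h₃, ← g₂.idx d (Nat.lt_succ_self d), ← g₃.idx d (by omega),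
      ← g₃.idx (d + 1) (by omega), ← (h.agree g).store]
    rfl
  | draw a i j =>
    intro d regs ρ σ m h
    refine .seq (i.halts ω h) (fun m₁ ⟨h₁, g₁⟩ => .seq (T := j.cost σ.inp + 2)
      (j.halts ω ((h.agree g₁).mono (Nat.le_succ d)))
      (fun m₂ ⟨h₂, g₂⟩ => .act_seq (.act ?_) le_rfl) le_rfl) (by simp only [Stmt.cost]; omega)
    have g := g₁.trans g₂ (Nat.le_succ d)
    refine ⟨fun r hr => g.idx r hr, ?_⟩
    -- Register number `d` serves twice, as index register for the row and as real register for the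
    -- draw; the two register files are separate.
    rw [Stmt.exec, ← h₁, ← h₂, ← g₂.idx d (Nat.lt_succ_self d), ← (h.agree g).store]
    simp [Memory.store, Instr.step, Store.setR]
  | seq s t hs ht =>
    intro d regs ρ σ m h
    refine .seq (hs h) (fun m₁ ⟨h₁, g₁⟩ => (ht (h.of_idx h₁ g₁)).mono le_rfl
      fun m₂ ⟨h₂, g₂⟩ => ⟨fun r hr => (h₂ r hr).trans (h₁ r hr), g₂⟩) ?_
    simp [Stmt.cost]
  | loop b s hs =>
    intro d regs ρ σ m h
    have h6 := h.six_le
    simp only [Stmt.comp, Stmt.cost]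
    set f : ℕ → Store → Store := fun i τ => s.exec ω (i :: ρ) τ
    have hf : ∀ k, (Store.iter f σ k).inp = σ.inp :=
      fun k => Store.iter_inp (fun i τ => s.exec_inp ω _ _) σ k
    have key : ∀ i (m₁ : Memory), (∀ r < d, m₁.idx r = m.idx r) → m₁.store = Store.iter f σ i →
        Rep d regs ρ (Store.iter f σ i) m₁ := fun i m₁ h₁ h₂ => h.of_idx h₁ h₂
    refine .act_seq (T₂ := σ.inp b * (s.cost σ.inp + 3) + 1) (Halts.mono (Halts.count
      (B := σ.inp b) (T₁ := s.cost σ.inp + 2)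
      (I := fun i m' => m'.idx d = i ∧ (∀ r < d, m'.idx r = m.idx r) ∧
        m'.store = Store.iter f σ i)
      (fun i m' h => h.1)
      (fun i m' h' => ((key i m' h'.2.1 h'.2.2).inp b).trans (congrFun (hf i) b)) ?_ ?_) le_rfl
      (fun m' h => h.2)) (by omega)
    · rintro i m₁ hi ⟨h₁, h₂, g⟩
      have h₃ := hs ((key i m₁ h₂ g).cons (d' := d + 1) (by omega) (by omega) h₁)
      rw [hf] at h₃
      refine .seq h₃ (fun m₂ ⟨k₁, k₂⟩ => (halts_incr (by omega)).mono le_rfl ?_) le_rfl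
      rintro m' rfl
      refine ⟨?_, ?_, ?_⟩
      · simp [k₁ d (by omega), h₁]
      · intro r hr
        have : r ≠ d := hr.ne
        simp [this, k₁ r (by omega), h₂ r hr, (show r ≠ d + 1 by omega)]
      · rw [Store.iter, show f i (Store.iter f σ i) = m₂.store from k₂.symm]
        ext1
        · funext r
          have : (r : ℕ) ≠ d := by omega
          simp [Memory.store, this, (show (r : ℕ) ≠ d + 1 by omega)]
        all_goals rfl
    · refine ⟨by simp [Instr.step], fun r hr => by simp [Instr.step, hr.ne], ?_⟩
      rw [Store.iter, ← h.store]
      ext1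
      · funext r
        have : (r : ℕ) ≠ d := by omega
        simp [Memory.store, Instr.step, this]
      all_goals rfl

/-! ### Growth of the cost -/

mutual

/-- Nesting depth of the sums over input register `b`. -/
def IExp.deg (b : Fin 6) : IExp → ℕ
  | .inp _ => 0
  | .var _ => 0
  | .const _ => 0
  | .add x y => max (x.deg b) (y.deg b)
  | .sub x y => max (x.deg b) (y.deg b)
  | .get _ i => i.deg b
  | .lt x y => max (x.deg b) (y.deg b)
  | .rlt x y => max (x.deg b) (y.deg b)
  | .ite c x y => max (c.deg b) (max (x.deg b) (y.deg b))
  | .sum b' e => e.deg b + if b' = b then 1 else 0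

/-- Nesting depth of the sums over input register `b`. -/
def RExp.deg (b : Fin 6) : RExp → ℕ
  | .cast x => x.deg b
  | .bin _ x y => max (x.deg b) (y.deg b)
  | .un _ x => x.deg b
  | .get _ i j => max (i.deg b) (j.deg b)
  | .ite c x y => max (c.deg b) (max (x.deg b) (y.deg b))
  | .sum b' e => e.deg b + if b' = b then 1 else 0

end

/-- Nesting depth of the loops over input register `b`. -/
def Stmt.deg (b : Fin 6) : Stmt → ℕ
  | .setI _ i e => max (i.deg b) (e.deg b)
  | .setR _ i j e => max (i.deg b) (max (j.deg b) (e.deg b))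
  | .draw _ i j => max (i.deg b) (j.deg b)
  | .seq s t => max (s.deg b) (t.deg b)
  | .loop b' s => s.deg b + if b' = b then 1 else 0

/-- The inputs, with the two large ones replaced by `1`. -/
def unitSize (β : Fin 6 → ℕ) : Fin 6 → ℕ := fun r => if r = 0 ∨ r = 1 then 1 else β r

section Growth

variable {β : Fin 6 → ℕ}

theorem growth_mono (h₀ : 1 ≤ β 0) (h₁ : 1 ≤ β 1) {x X i j i' j' : ℕ}
    (h : x ≤ X * (β 0 ^ i * β 1 ^ j)) (hi : i ≤ i') (hj : j ≤ j') :
    x ≤ X * (β 0 ^ i' * β 1 ^ j') := by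
  refine h.trans ?_
  gcongr

theorem growth_const (h₀ : 1 ≤ β 0) (h₁ : 1 ≤ β 1) (X i j : ℕ) :
    X ≤ X * (β 0 ^ i * β 1 ^ j) :=
  growth_mono h₀ h₁ (i := 0) (j := 0) (by simp) (Nat.zero_le _) (Nat.zero_le _)

/-- A loop over register 0 or 1 raises the exponent of that register by one; any other loop only
multiplies the coefficient. The overheads `u` and `v` are absorbed because both large inputs are at
least 1. -/
theorem growth_loop (h₀ : 1 ≤ β 0) (h₁ : 1 ≤ β 1) {x X i j : ℕ} (u v : ℕ) (b : Fin 6)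
    (h : x ≤ X * (β 0 ^ i * β 1 ^ j)) :
    β b * (x + u) + v ≤ (unitSize β b * (X + u) + v) *
      (β 0 ^ (i + if b = 0 then 1 else 0) * β 1 ^ (j + if b = 1 then 1 else 0)) := by
  have hb : β b = unitSize β b * (β 0 ^ (if b = 0 then 1 else 0) *
      β 1 ^ (if b = 1 then 1 else 0)) := by
    by_cases hb₀ : b = 0
    · subst hb₀; simp [unitSize]
    · by_cases hb₁ : b = 1
      · subst hb₁; simp [unitSize]
      · simp [unitSize, hb₀, hb₁]
  have hu := growth_const h₀ h₁ u i j
  have hv := growth_const h₀ h₁ v (i + if b = 0 then 1 else 0) (j + if b = 1 then 1 else 0)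
  calc β b * (x + u) + v
      ≤ β b * ((X + u) * (β 0 ^ i * β 1 ^ j)) + v := by
        gcongr
        rw [add_mul]
        omega
    _ ≤ _ := by
        rw [add_mul (unitSize β b * _)]
        refine Nat.add_le_add (le_of_eq ?_) hv
        conv_lhs => rw [hb]
        rw [pow_add, pow_add]
        ring

end Growth

mutual

theorem IExp.cost_le {β : Fin 6 → ℕ} (h₀ : 1 ≤ β 0) (h₁ : 1 ≤ β 1) : ∀ e : IExp,
    e.cost β ≤ e.cost (unitSize β) * (β 0 ^ e.deg 0 * β 1 ^ e.deg 1)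
  | .inp _ => growth_const h₀ h₁ _ _ _
  | .var _ => growth_const h₀ h₁ _ _ _
  | .const _ => growth_const h₀ h₁ _ _ _
  | .add x y => by
    simp only [IExp.cost, IExp.deg, add_mul]
    exact Nat.add_le_add (Nat.add_le_add
      (growth_mono h₀ h₁ (x.cost_le h₀ h₁) (by simp) (by simp))
      (growth_mono h₀ h₁ (y.cost_le h₀ h₁) (by simp) (by simp))) (growth_const h₀ h₁ _ _ _)
  | .sub x y => by
    simp only [IExp.cost, IExp.deg, add_mul]
    exact Nat.add_le_add (Nat.add_le_add
      (growth_mono h₀ h₁ (x.cost_le h₀ h₁) (by simp) (by simp))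
      (growth_mono h₀ h₁ (y.cost_le h₀ h₁) (by simp) (by simp))) (growth_const h₀ h₁ _ _ _)
  | .get _ i => by
    simp only [IExp.cost, IExp.deg, add_mul]
    exact Nat.add_le_add (i.cost_le h₀ h₁) (growth_const h₀ h₁ _ _ _)
  | .lt x y => by
    simp only [IExp.cost, IExp.deg, add_mul]
    exact Nat.add_le_add (Nat.add_le_add
      (growth_mono h₀ h₁ (x.cost_le h₀ h₁) (by simp) (by simp))
      (growth_mono h₀ h₁ (y.cost_le h₀ h₁) (by simp) (by simp))) (growth_const h₀ h₁ _ _ _)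
  | .rlt x y => by
    simp only [IExp.cost, IExp.deg, add_mul]
    exact Nat.add_le_add (Nat.add_le_add
      (growth_mono h₀ h₁ (x.cost_le h₀ h₁) (by simp) (by simp))
      (growth_mono h₀ h₁ (y.cost_le h₀ h₁) (by simp) (by simp))) (growth_const h₀ h₁ _ _ _)
  | .ite c x y => by
    simp only [IExp.cost, IExp.deg, add_mul]
    exact Nat.add_le_add (Nat.add_le_add (Nat.add_le_add
      (growth_mono h₀ h₁ (c.cost_le h₀ h₁) (by simp) (by simp))
      (growth_mono h₀ h₁ (x.cost_le h₀ h₁) (by simp) (by simp)))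
      (growth_mono h₀ h₁ (y.cost_le h₀ h₁) (by simp) (by simp))) (growth_const h₀ h₁ _ _ _)
  | .sum b e => growth_loop h₀ h₁ 4 3 b (e.cost_le h₀ h₁)

theorem RExp.cost_le {β : Fin 6 → ℕ} (h₀ : 1 ≤ β 0) (h₁ : 1 ≤ β 1) : ∀ e : RExp,
    e.cost β ≤ e.cost (unitSize β) * (β 0 ^ e.deg 0 * β 1 ^ e.deg 1)
  | .cast x => by
    simp only [RExp.cost, RExp.deg, add_mul]
    exact Nat.add_le_add (x.cost_le h₀ h₁) (growth_const h₀ h₁ _ _ _)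
  | .bin _ x y => by
    simp only [RExp.cost, RExp.deg, add_mul]
    exact Nat.add_le_add (Nat.add_le_add
      (growth_mono h₀ h₁ (x.cost_le h₀ h₁) (by simp) (by simp))
      (growth_mono h₀ h₁ (y.cost_le h₀ h₁) (by simp) (by simp))) (growth_const h₀ h₁ _ _ _)
  | .un _ x => by
    simp only [RExp.cost, RExp.deg, add_mul]
    exact Nat.add_le_add (x.cost_le h₀ h₁) (growth_const h₀ h₁ _ _ _)
  | .get _ x y => by
    simp only [RExp.cost, RExp.deg, add_mul]
    exact Nat.add_le_add (Nat.add_le_add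
      (growth_mono h₀ h₁ (x.cost_le h₀ h₁) (by simp) (by simp))
      (growth_mono h₀ h₁ (y.cost_le h₀ h₁) (by simp) (by simp))) (growth_const h₀ h₁ _ _ _)
  | .ite c x y => by
    simp only [RExp.cost, RExp.deg, add_mul]
    exact Nat.add_le_add (Nat.add_le_add (Nat.add_le_add
      (growth_mono h₀ h₁ (c.cost_le h₀ h₁) (by simp) (by simp))
      (growth_mono h₀ h₁ (x.cost_le h₀ h₁) (by simp) (by simp)))
      (growth_mono h₀ h₁ (y.cost_le h₀ h₁) (by simp) (by simp))) (growth_const h₀ h₁ _ _ _)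
  | .sum b e => growth_loop h₀ h₁ 4 3 b (e.cost_le h₀ h₁)

end

/-- The cost is a polynomial with nonnegative coefficients, and each of its monomials has degree at
most the nesting depth in each large input. Setting these inputs to 1 sums the coefficients. -/
theorem Stmt.cost_le {β : Fin 6 → ℕ} (h₀ : 1 ≤ β 0) (h₁ : 1 ≤ β 1) (s : Stmt) :
    s.cost β ≤ s.cost (unitSize β) * (β 0 ^ s.deg 0 * β 1 ^ s.deg 1) := by
  induction s with
  | setI a x y =>
    simp only [Stmt.cost, Stmt.deg, add_mul]
    exact Nat.add_le_add (Nat.add_le_add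
      (growth_mono h₀ h₁ (x.cost_le h₀ h₁) (by simp) (by simp))
      (growth_mono h₀ h₁ (y.cost_le h₀ h₁) (by simp) (by simp))) (growth_const h₀ h₁ _ _ _)
  | setR a i j e =>
    simp only [Stmt.cost, Stmt.deg, add_mul]
    exact Nat.add_le_add (Nat.add_le_add (Nat.add_le_add
      (growth_mono h₀ h₁ (i.cost_le h₀ h₁) (by simp) (by simp))
      (growth_mono h₀ h₁ (j.cost_le h₀ h₁) (by simp) (by simp)))
      (growth_mono h₀ h₁ (e.cost_le h₀ h₁) (by simp) (by simp))) (growth_const h₀ h₁ _ _ _)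
  | draw a x y =>
    simp only [Stmt.cost, Stmt.deg, add_mul]
    exact Nat.add_le_add (Nat.add_le_add
      (growth_mono h₀ h₁ (x.cost_le h₀ h₁) (by simp) (by simp))
      (growth_mono h₀ h₁ (y.cost_le h₀ h₁) (by simp) (by simp))) (growth_const h₀ h₁ _ _ _)
  | seq s t hs ht =>
    simp only [Stmt.cost, Stmt.deg, add_mul]
    exact Nat.add_le_add (growth_mono h₀ h₁ hs (by simp) (by simp))
      (growth_mono h₀ h₁ ht (by simp) (by simp))
  | loop b s hs => exact growth_loop h₀ h₁ 3 2 b hs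

/-! ### Reads and writes -/

mutual

/-- The expression does not read index array `a` (`r = false`) or real array `a` (`r = true`). -/
def IExp.avoids (r : Bool) (a : ℕ) : IExp → Bool
  | .inp _ => true
  | .var _ => true
  | .const _ => true
  | .add x y => x.avoids r a && y.avoids r a
  | .sub x y => x.avoids r a && y.avoids r a
  | .get b i => (r || b != a) && i.avoids r a
  | .lt x y => x.avoids r a && y.avoids r a
  | .rlt x y => x.avoids r a && y.avoids r a
  | .ite c x y => c.avoids r a && (x.avoids r a && y.avoids r a)
  | .sum _ e => e.avoids r a

/-- The expression does not read index array `a` (`r = false`) or real array `a` (`r = true`). -/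
def RExp.avoids (r : Bool) (a : ℕ) : RExp → Bool
  | .cast x => x.avoids r a
  | .bin _ x y => x.avoids r a && y.avoids r a
  | .un _ x => x.avoids r a
  | .get b i j => (!r || b != a) && (i.avoids r a && j.avoids r a)
  | .ite c x y => c.avoids r a && (x.avoids r a && y.avoids r a)
  | .sum _ e => e.avoids r a

end

/-- The stores agree except possibly on one array. -/
structure Store.EqOff (r : Bool) (a : ℕ) (σ τ : Store) : Prop where
  inp : σ.inp = τ.inp
  iarr : ∀ b, (r || b != a) = true → σ.iarr b = τ.iarr b
  varr : ∀ b, (!r || b != a) = true → σ.varr b = τ.varr b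

mutual

theorem IExp.eval_congr {r : Bool} {a : ℕ} {σ τ : Store} (h : Store.EqOff r a σ τ) :
    ∀ (e : IExp) (ρ : List ℕ), e.avoids r a = true → e.eval ρ σ = e.eval ρ τ
  | .inp _, ρ, _ => by simp only [IExp.eval, h.inp]
  | .var _, ρ, _ => by simp only [IExp.eval]
  | .const _, ρ, _ => by simp only [IExp.eval]
  | .add x y, ρ, he => by
    simp only [IExp.avoids, Bool.and_eq_true] at he
    simp only [IExp.eval, x.eval_congr h ρ he.1, y.eval_congr h ρ he.2]
  | .sub x y, ρ, he => by
    simp only [IExp.avoids, Bool.and_eq_true] at he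
    simp only [IExp.eval, x.eval_congr h ρ he.1, y.eval_congr h ρ he.2]
  | .get b i, ρ, he => by
    rw [IExp.avoids, Bool.and_eq_true] at he
    simp only [IExp.eval, i.eval_congr h ρ he.2, h.iarr b he.1]
  | .lt x y, ρ, he => by
    simp only [IExp.avoids, Bool.and_eq_true] at he
    simp only [IExp.eval, x.eval_congr h ρ he.1, y.eval_congr h ρ he.2]
  | .rlt x y, ρ, he => by
    simp only [IExp.avoids, Bool.and_eq_true] at he
    simp only [IExp.eval, x.eval_congr h ρ he.1, y.eval_congr h ρ he.2]
  | .ite c x y, ρ, he => by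
    simp only [IExp.avoids, Bool.and_eq_true] at he
    simp only [IExp.eval, c.eval_congr h ρ he.1, x.eval_congr h ρ he.2.1, y.eval_congr h ρ he.2.2]
  | .sum b e, ρ, he => by
    simp only [IExp.avoids] at he
    simp only [IExp.eval, h.inp, fun i => e.eval_congr h (i :: ρ) he]

theorem RExp.eval_congr {r : Bool} {a : ℕ} {σ τ : Store} (h : Store.EqOff r a σ τ) :
    ∀ (e : RExp) (ρ : List ℕ), e.avoids r a = true → e.eval ρ σ = e.eval ρ τ
  | .cast x, ρ, he => by
    simp only [RExp.avoids] at he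
    simp only [RExp.eval, x.eval_congr h ρ he]
  | .bin _ x y, ρ, he => by
    simp only [RExp.avoids, Bool.and_eq_true] at he
    simp only [RExp.eval, x.eval_congr h ρ he.1, y.eval_congr h ρ he.2]
  | .un _ x, ρ, he => by
    simp only [RExp.avoids] at he
    simp only [RExp.eval, x.eval_congr h ρ he]
  | .get b i j, ρ, he => by
    rw [RExp.avoids, Bool.and_eq_true, Bool.and_eq_true] at he
    simp only [RExp.eval, i.eval_congr h ρ he.2.1, j.eval_congr h ρ he.2.2, h.varr b he.1]
  | .ite c x y, ρ, he => by
    simp only [RExp.avoids, Bool.and_eq_true] at he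
    simp only [RExp.eval, c.eval_congr h ρ he.1, x.eval_congr h ρ he.2.1, y.eval_congr h ρ he.2.2]
  | .sum b e, ρ, he => by
    simp only [RExp.avoids] at he
    simp only [RExp.eval, h.inp, fun i => e.eval_congr h (i :: ρ) he]

end

/-- The statement writes to index array `a`. -/
def Stmt.writesI (a : ℕ) : Stmt → Bool
  | .setI b _ _ => b == a
  | .setR _ _ _ _ => false
  | .draw _ _ _ => false
  | .seq s t => s.writesI a || t.writesI a
  | .loop _ s => s.writesI a

/-- The statement writes to real array `a`. -/
def Stmt.writesR (a : ℕ) : Stmt → Bool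
  | .setI _ _ _ => false
  | .setR b _ _ _ => b == a
  | .draw b _ _ => b == a
  | .seq s t => s.writesR a || t.writesR a
  | .loop _ s => s.writesR a

/-- Induction over the rounds of a loop. -/
theorem Stmt.exec_loop {ω : Tape} {b : Fin 6} {s : Stmt} {ρ : List ℕ} {σ : Store}
    (I : ℕ → Store → Prop) (h₀ : I 0 σ)
    (hs : ∀ i τ, i < σ.inp b → τ.inp = σ.inp → I i τ → I (i + 1) (s.exec ω (i :: ρ) τ)) :
    I (σ.inp b) ((Stmt.loop b s).exec ω ρ σ) := by
  have : ∀ k ≤ σ.inp b, I k (Store.iter (fun i τ => s.exec ω (i :: ρ) τ) σ k) := by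
    intro k
    induction k with
    | zero => exact fun _ => h₀
    | succ k ih =>
      exact fun hk => hs _ _ (by omega) (Store.iter_inp (fun i τ => s.exec_inp ω _ _) σ k)
        (ih (by omega))
  exact this _ le_rfl

theorem Stmt.exec_iarr {ω : Tape} {a : ℕ} {s : Stmt} (h : s.writesI a = false) :
    ∀ (ρ : List ℕ) (σ : Store), (s.exec ω ρ σ).iarr a = σ.iarr a := by
  induction s with
  | setI b i e =>
    intro ρ σ
    have : a ≠ b := fun hab => by simp [Stmt.writesI, hab] at h
    simp [Stmt.exec, Store.setI, this]
  | setR b i j e => intros; rfl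
  | draw b i j => intros; rfl
  | seq s t hs ht =>
    intro ρ σ
    simp only [Stmt.writesI, Bool.or_eq_false_iff] at h
    exact (ht h.2 _ _).trans (hs h.1 _ _)
  | loop b s hs =>
    intro ρ σ
    exact Stmt.exec_loop (fun _ τ => τ.iarr a = σ.iarr a) rfl fun i τ _ _ hτ => (hs h _ _).trans hτ

theorem Stmt.exec_varr {ω : Tape} {a : ℕ} {s : Stmt} (h : s.writesR a = false) :
    ∀ (ρ : List ℕ) (σ : Store), (s.exec ω ρ σ).varr a = σ.varr a := by
  induction s with
  | setI b i e => intros; rfl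
  | setR b i j e =>
    intro ρ σ
    have : a ≠ b := fun hab => by simp [Stmt.writesR, hab] at h
    simp [Stmt.exec, Store.setR, this]
  | draw b i j =>
    intro ρ σ
    have : a ≠ b := fun hab => by simp [Stmt.writesR, hab] at h
    simp [Stmt.exec, Store.setR, this]
  | seq s t hs ht =>
    intro ρ σ
    simp only [Stmt.writesR, Bool.or_eq_false_iff] at h
    exact (ht h.2 _ _).trans (hs h.1 _ _)
  | loop b s hs =>
    intro ρ σ
    exact Stmt.exec_loop (fun _ τ => τ.varr a = σ.varr a) rfl fun i τ _ _ hτ => (hs h _ _).trans hτ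

/-! ### Filling arrays -/

/-- Fill the entries below the bound `b` of an index array. -/
def Stmt.fillI (a : ℕ) (b : Fin 6) (e : IExp) : Stmt := .loop b (.setI a (.var 0) e)

/-- Fill the entries below the bounds `b` and `c` of a real array. -/
def Stmt.fillR (a : ℕ) (b c : Fin 6) (e : RExp) : Stmt :=
  .loop b (.loop c (.setR a (.var 1) (.var 0) e))

/-- As `e` does not read the array being written, it has the same value in every round as in the
initial store. Updates that depend on the old contents therefore go through a buffer array. -/
theorem Stmt.exec_fillI {ω : Tape} {a : ℕ} {b : Fin 6} {e : IExp} (he : e.avoids false a = true)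
    (ρ : List ℕ) (σ : Store) {i : ℕ} (hi : i < σ.inp b) :
    ((Stmt.fillI a b e).exec ω ρ σ).iarr a i = e.eval (i :: ρ) σ := by
  have := Stmt.exec_loop (ω := ω) (b := b) (s := .setI a (.var 0) e) (ρ := ρ) (σ := σ)
    (fun k τ => Store.EqOff false a τ σ ∧ ∀ i < k, τ.iarr a i = e.eval (i :: ρ) σ)
    ⟨⟨rfl, fun _ _ => rfl, fun _ _ => rfl⟩, by simp⟩ ?_
  · exact this.2 i hi
  · rintro k τ hk hτ ⟨h, h'⟩
    refine ⟨⟨hτ, fun b' hb' => ?_, fun b' hb' => h.varr b' hb'⟩, fun i hi => ?_⟩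
    · have : b' ≠ a := by simpa using hb'
      simpa [Stmt.exec, Store.setI, this] using h.iarr b' hb'
    · rw [Stmt.exec, e.eval_congr h _ he]
      rcases eq_or_ne i k with rfl | hik
      · simp [Store.setI, IExp.eval]
      · simp [Store.setI, IExp.eval, hik, h' i (by omega)]

theorem Stmt.exec_fillR {ω : Tape} {a : ℕ} {b c : Fin 6} {e : RExp} (he : e.avoids true a = true)
    (ρ : List ℕ) (σ : Store) {i j : ℕ} (hi : i < σ.inp b) (hj : j < σ.inp c) :
    ((Stmt.fillR a b c e).exec ω ρ σ).varr a i j = e.eval (j :: i :: ρ) σ := by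
  have := Stmt.exec_loop (ω := ω) (b := b) (s := .loop c (.setR a (.var 1) (.var 0) e)) (ρ := ρ)
    (σ := σ) (fun k τ => Store.EqOff true a τ σ ∧
      ∀ i < k, ∀ j < σ.inp c, τ.varr a i j = e.eval (j :: i :: ρ) σ)
    ⟨⟨rfl, fun _ _ => rfl, fun _ _ => rfl⟩, by simp⟩ ?_
  · exact this.2 i hi j hj
  · rintro k τ hk hτ ⟨h, h'⟩
    -- The inner invariant keeps the finished rows and adds the first `l` entries of row `k`.
    have := Stmt.exec_loop (ω := ω) (b := c) (s := .setR a (.var 1) (.var 0) e) (ρ := k :: ρ)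
      (σ := τ) (fun l υ => Store.EqOff true a υ σ ∧
        (∀ i < k, ∀ j < σ.inp c, υ.varr a i j = e.eval (j :: i :: ρ) σ) ∧
        ∀ j < l, υ.varr a k j = e.eval (j :: k :: ρ) σ) ⟨h, h', by simp⟩ ?_
    · refine ⟨this.1, fun i hi j hj => ?_⟩
      rcases Nat.lt_succ_iff_lt_or_eq.1 hi with hi | rfl
      exacts [this.2.1 i hi j hj, this.2.2 j (by rwa [hτ])]
    · rintro l υ hl hυ ⟨g, g', g''⟩
      rw [Stmt.exec, e.eval_congr g _ he]
      refine ⟨⟨hυ.trans hτ, fun b' hb' => g.iarr b' hb', fun b' hb' => ?_⟩, fun i hi j hj => ?_,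
        fun j hj => ?_⟩
      · have : b' ≠ a := by simpa using hb'
        simpa [Store.setR, this] using g.varr b' hb'
      · simp [Store.setR, IExp.eval, hi.ne, g' i hi j hj]
      · rcases eq_or_ne j l with rfl | hjl
        · simp [Store.setR, IExp.eval]
        · simp [Store.setR, IExp.eval, hjl, g'' j (by omega)]

/-! ### Positions and sequential selection -/

/-- Number of elements of `S` with index below `k`. -/
def countBelow {N : ℕ} (S : Finset (Fin N)) (k : ℕ) : ℕ := (S.filter (fun j : Fin N => (j : ℕ) < k)).card

section Position

variable {N : ℕ} {S : Finset (Fin N)}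

theorem countBelow_zero : countBelow S 0 = 0 := by simp [countBelow]

theorem countBelow_card : countBelow S N = S.card := by
  rw [countBelow, Finset.filter_true_of_mem fun j _ => j.2]

theorem countBelow_succ (i : Fin N) :
    countBelow S (i + 1) = countBelow S i + if i ∈ S then 1 else 0 := by
  have : S.filter (fun j : Fin N => (j : ℕ) < i + 1) =
      S.filter (fun j : Fin N => (j : ℕ) < i) ∪ S.filter (fun j => j = i) := by
    ext j
    simp only [Finset.mem_filter, Finset.mem_union, Fin.ext_iff, ← and_or_left,
      Nat.lt_succ_iff_lt_or_eq]
  rw [countBelow, this, Finset.card_union_of_disjoint, Finset.filter_eq']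
  · rw [countBelow]; split_ifs <;> simp
  · rw [Finset.disjoint_left]
    intro j hj hj'
    simp only [Finset.mem_filter, Fin.ext_iff] at hj hj'
    omega

theorem position_lt {i j : Fin N} (hi : i ∈ S) (hij : i < j) : position S i < position S j := by
  refine Finset.card_lt_card ((Finset.ssubset_iff_of_subset ?_).2 ⟨i, ?_, ?_⟩)
  · intro l hl
    simp only [Finset.mem_filter] at hl ⊢
    exact ⟨hl.1, hl.2.trans hij⟩
  · simp [hi, hij]
  · simp

theorem position_injOn : Set.InjOn (position S) S := by
  intro i hi j hj h
  rcases lt_trichotomy i j with hij | hij | hij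
  exacts [absurd h (position_lt hi hij).ne, hij, absurd h (position_lt hj hij).ne']

theorem position_lt_card {i : Fin N} (hi : i ∈ S) : position S i < S.card := by
  refine Finset.card_lt_card ((Finset.ssubset_iff_of_subset (Finset.filter_subset _ _)).2
    ⟨i, hi, ?_⟩)
  simp

/-- Positions are distinct and smaller than the cardinality, hence enumerate the whole range. This
turns a loop over list positions into a sum over `S`. -/
theorem sum_position {M : Type*} [AddCommMonoid M] (f : ℕ → M) :
    ∑ t ∈ Finset.range S.card, f t = ∑ j ∈ S, f (position S j) := by
  have : S.image (position S) = Finset.range S.card := by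
    refine Finset.eq_of_subset_of_card_le ?_ ?_
    · intro t ht
      obtain ⟨j, hj, rfl⟩ := Finset.mem_image.1 ht
      exact Finset.mem_range.2 (position_lt_card hj)
    · rw [Finset.card_range, Finset.card_image_of_injOn position_injOn]
  rw [← this, Finset.sum_image position_injOn]

theorem mem_sample {m : ℕ} {u : ℕ → ℝ} {i : Fin N} : i ∈ sample N m u ↔
    ((N : ℝ) - (i : ℕ)) * u i < (m : ℝ) - selectedBefore N m u i := by
  simp [sample]

theorem selectedBefore_eq_countBelow (m : ℕ) (u : ℕ → ℝ) :
    ∀ k ≤ N, selectedBefore N m u k = countBelow (sample N m u) k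
  | 0, _ => countBelow_zero.symm
  | k + 1, hk => by
    have := countBelow_succ (S := sample N m u) ⟨k, hk⟩
    simp only [mem_sample] at this
    rw [this, selectedBefore, selectedBefore_eq_countBelow m u k (by omega)]

/-- When nothing more is needed, the test fails since draws are nonnegative; when every remaining
item is needed, it succeeds since draws are below 1. At `k = N` the two bounds force exactly `m`
selections. -/
theorem selectedBefore_bounds {m : ℕ} {u : ℕ → ℝ} (hm : m ≤ N) (h₀ : ∀ i, 0 ≤ u i)
    (h₁ : ∀ i, u i < 1) : ∀ k ≤ N, selectedBefore N m u k ≤ m ∧ m + k ≤ N + selectedBefore N m u k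
  | 0, _ => ⟨Nat.zero_le _, by simpa [selectedBefore]⟩
  | k + 1, hk => by
    obtain ⟨ha, hb⟩ := selectedBefore_bounds hm h₀ h₁ k (by omega)
    have hN : (0 : ℝ) < (N : ℝ) - k := by
      rw [sub_pos, Nat.cast_lt]; omega
    rw [selectedBefore]
    split_ifs with h
    · have : (0 : ℝ) < (m : ℝ) - selectedBefore N m u k :=
        (mul_nonneg hN.le (h₀ k)).trans_lt h
      rw [sub_pos, Nat.cast_lt] at this
      omega
    · refine ⟨by omega, ?_⟩
      by_contra hc
      have hc' : m + k = N + selectedBefore N m u k := by omega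
      have hc'' : (m : ℝ) + k = N + selectedBefore N m u k := by exact_mod_cast hc'
      refine h ?_
      rw [show (m : ℝ) - selectedBefore N m u k = N - k by linarith]
      nlinarith [h₁ k]

theorem card_sample {m : ℕ} {u : ℕ → ℝ} (hm : m ≤ N) (h₀ : ∀ i, 0 ≤ u i) (h₁ : ∀ i, u i < 1) :
    (sample N m u).card = m := by
  rw [← countBelow_card, ← selectedBefore_eq_countBelow m u N le_rfl]
  have := selectedBefore_bounds hm h₀ h₁ N le_rfl
  omega

end Position

/-- Sums over the node pairs of the subsample. -/
theorem sum_pairs {N : ℕ} (S : Finset (Fin N)) (F : Fin N → Fin N → ℝ) :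
    ∑ e ∈ pairs S, F e.1 e.2 =
      ∑ i, ∑ j ∈ S, if (i ∈ S → i < j) then F i j else 0 := by
  rw [pairs, Finset.sum_filter, ← Finset.univ_product_univ, Finset.sum_product]
  refine Finset.sum_congr rfl fun i _ => ?_
  rw [← Finset.sum_filter_add_sum_filter_not Finset.univ (· ∈ S)]
  simp only [Finset.filter_mem_eq_inter, Finset.univ_inter]
  rw [Finset.sum_eq_zero (s := Finset.univ.filter (· ∉ S)), add_zero]
  · exact Finset.sum_congr rfl fun j hj => by simp [hj]
  · intro j hj
    simp [(Finset.mem_filter.1 hj).2]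

/-! ### Gram–Schmidt -/

theorem gramSchmidt_castLE {E : Type*} [NormedAddCommGroup E] [InnerProductSpace ℝ E] {K L : ℕ}
    (h : K ≤ L) (f : Fin L → E) (k : Fin K) :
    InnerProductSpace.gramSchmidt ℝ (fun l => f (Fin.castLE h l)) k =
      InnerProductSpace.gramSchmidt ℝ f (Fin.castLE h k) := by
  induction k using WellFoundedLT.induction with
  | ind k ih =>
    rw [InnerProductSpace.gramSchmidt_def, InnerProductSpace.gramSchmidt_def]
    have : Finset.Iio (Fin.castLE h k) =
        (Finset.Iio k).map (Fin.castLEEmb h) := by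
      ext l
      simp only [Finset.mem_Iio, Finset.mem_map, Fin.castLEEmb_apply]
      constructor
      · intro hl
        have hlk : (l : ℕ) < k := hl
        exact ⟨⟨l, hlk.trans k.2⟩, hlk, rfl⟩
      · rintro ⟨l, hl, rfl⟩
        exact hl
    rw [this, Finset.sum_map]
    congr 1
    exact Finset.sum_congr rfl fun l hl => by
      rw [ih l (Finset.mem_Iio.1 hl)]
      rfl

theorem orthColumns_castLE {N K L : ℕ} (h : K ≤ L) {Y : Matrix (Fin N) (Fin K) ℝ}
    {Y' : Matrix (Fin N) (Fin L) ℝ} (hY : ∀ i k, Y i k = Y' i (Fin.castLE h k)) (i : Fin N)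
    (k : Fin K) : orthColumns Y i k = orthColumns Y' i (Fin.castLE h k) := by
  obtain rfl : Y = fun i k => Y' i (Fin.castLE h k) := by ext i k; exact hY i k
  unfold orthColumns InnerProductSpace.gramSchmidtNormed
  rw [← gramSchmidt_castLE h]

/-- Matrix multiplication acts column by column and Gram–Schmidt only looks back, so discarding the
last columns commutes with the whole iteration. -/
theorem leftVectors_castLE {N K L : ℕ} {ι : Type} [Fintype ι] (h : K ≤ L)
    (A : Matrix (Fin N) ι ℝ) {X : Matrix ι (Fin K) ℝ} {X' : Matrix ι (Fin L) ℝ}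
    (hX : ∀ i k, X i k = X' i (Fin.castLE h k)) : ∀ (q : ℕ) (i : Fin N) (k : Fin K),
    leftVectors A X q i k = leftVectors A X' q i (Fin.castLE h k)
  | 0, i, k => orthColumns_castLE h (fun i k => by simp [Matrix.mul_apply, hX]) i k
  | q + 1, i, k => orthColumns_castLE h (fun i k => by
      simp [Matrix.mul_apply, leftVectors_castLE h A hX q]) i k

/-- Entries of the unnormalised Gram–Schmidt columns. -/
noncomputable def gsEntry {N K : ℕ} (Y : Matrix (Fin N) (Fin K) ℝ) (k : Fin K) (i : Fin N) : ℝ :=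
  InnerProductSpace.gramSchmidt ℝ
    (fun l : Fin K => (WithLp.toLp 2 (fun r => Y r l) : EuclideanSpace ℝ (Fin N))) k i

/-- The Gram–Schmidt recursion in coordinates, in the form the program evaluates. For a zero column
`l` both sides divide by zero in the same way, so dependent columns need no separate case. -/
theorem gsEntry_eq {N K : ℕ} (Y : Matrix (Fin N) (Fin K) ℝ) (k : Fin K) (i : Fin N) :
    gsEntry Y k i = Y i k - ∑ l, if l < k then
      (∑ r, gsEntry Y l r * Y r k) / (∑ r, gsEntry Y l r * gsEntry Y l r) * gsEntry Y l i
      else 0 := by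
  rw [gsEntry, eq_sub_of_add_eq (InnerProductSpace.gramSchmidt_def'' ℝ _ k).symm]
  rw [PiLp.sub_apply, WithLp.ofLp_sum, Finset.sum_apply, ← Finset.sum_filter,
    show Finset.univ.filter (· < k) = Finset.Iio k by ext; simp]
  congr 1
  refine Finset.sum_congr rfl fun l _ => ?_
  rw [PiLp.smul_apply, smul_eq_mul, gsEntry, RCLike.ofReal_real_eq_id, id,
    ← real_inner_self_eq_norm_sq, PiLp.inner_apply, PiLp.inner_apply]
  simp only [gsEntry, RCLike.inner_apply, conj_trivial, mul_comm (Y _ k)]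

theorem orthColumns_eq {N K : ℕ} (Y : Matrix (Fin N) (Fin K) ℝ) (k : Fin K) (i : Fin N) :
    orthColumns Y i k = gsEntry Y k i / √(∑ r, gsEntry Y k r * gsEntry Y k r) := by
  rw [orthColumns, InnerProductSpace.gramSchmidtNormed, PiLp.smul_apply, EuclideanSpace.norm_eq]
  simp only [gsEntry, smul_eq_mul, Real.norm_eq_abs, sq_abs, ← sq, div_eq_inv_mul]
  rfl

/-! ### Nearest centres -/

/-- The smallest minimiser of `d` on `{0, …, K - 1}`, as a count. -/
theorem count_eq_sInf {K L : ℕ} (hK : 1 ≤ K) (hL : K ≤ L) (d : ℕ → ℝ) (P : ℕ → Prop)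
    [DecidablePred P] (hP : ∀ k < L, P k ↔ ∃ k' ≤ k, k' < K ∧ ∀ l < K, d k' ≤ d l) :
    (∑ k ∈ Finset.range L, if P k then 0 else 1) = sInf {k | k < K ∧ ∀ l < K, d k ≤ d l} := by
  have hne : {k | k < K ∧ ∀ l < K, d k ≤ d l}.Nonempty := by
    obtain ⟨k, hk, hmin⟩ := Finset.exists_min_image (Finset.range K) d
      ⟨0, Finset.mem_range.2 hK⟩
    exact ⟨k, Finset.mem_range.1 hk, fun l hl => hmin l (Finset.mem_range.2 hl)⟩
  set k₀ := sInf {k | k < K ∧ ∀ l < K, d k ≤ d l} with hk₀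
  have hmem : k₀ < K ∧ ∀ l < K, d k₀ ≤ d l := Nat.sInf_mem hne
  have : ∀ k ∈ Finset.range L, (if P k then 0 else 1) = if k < k₀ then 1 else 0 := by
    intro k hk
    -- On the range, `P` holds exactly from the smallest minimiser on, so the number of failures is
    -- that minimiser.
    have : P k ↔ ¬ k < k₀ := by
      rw [hP k (Finset.mem_range.1 hk), not_lt]
      constructor
      · rintro ⟨k', hk', h⟩
        exact (Nat.sInf_le h).trans hk'
      · exact fun h => ⟨k₀, h, hmem⟩
    by_cases h : k < k₀ <;> simp [this, h]
  rw [Finset.sum_congr rfl this, ← Finset.sum_filter, Finset.sum_const, smul_eq_mul, mul_one]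
  have : (Finset.range L).filter (· < k₀) = Finset.range k₀ := by
    ext k
    simp only [Finset.mem_filter, Finset.mem_range]
    omega
  rw [this, Finset.card_range]

/-- Sums in the language run only up to an input register, so a sum over the coordinates of
candidate `K` is a masked sum up to `L`. -/
theorem sum_range_of_le {K L : ℕ} (h : K ≤ L) (f : ℕ → ℝ) :
    (∑ d ∈ Finset.range L, if d < K then f d else 0) = ∑ d : Fin K, f d := by
  rw [← Finset.sum_range, ← Finset.sum_filter]
  congr 1
  ext d
  simp only [Finset.mem_filter, Finset.mem_range]
  omega

theorem dist_eq_of_coords {K L : ℕ} (h : K ≤ L) {x y : EuclideanSpace ℝ (Fin K)} {a b : ℕ → ℝ}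
    (hx : ∀ d : Fin K, a d = x d) (hy : ∀ d : Fin K, b d = y d) :
    √(∑ d ∈ Finset.range L, if d < K then (a d - b d) * (a d - b d) else 0) = dist x y := by
  rw [sum_range_of_le h, EuclideanSpace.dist_eq]
  congr 1
  refine Finset.sum_congr rfl fun d _ => ?_
  rw [hx, hy, Real.dist_eq, sq_abs, sq]

theorem norm_eq_of_coords {K L : ℕ} (h : K ≤ L) {x : EuclideanSpace ℝ (Fin K)} {a : ℕ → ℝ}
    (hx : ∀ d : Fin K, a d = x d) :
    √(∑ d ∈ Finset.range L, if d < K then a d * a d else 0) = ‖x‖ := by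
  rw [sum_range_of_le h, EuclideanSpace.norm_eq]
  congr 1
  refine Finset.sum_congr rfl fun d _ => ?_
  rw [hx, Real.norm_eq_abs, sq_abs, sq]

/-! ### The law of the sample -/

/-- The adaptive thresholds become constants once the outcome is fixed: condition `i` involves draw
`i` alone, which makes the event a product set. -/
theorem sample_eq_iff {N n : ℕ} {u : ℕ → ℝ} {U : Finset (Fin N)} : sample N n u = U ↔
    ∀ i : Fin N, ((N : ℝ) - (i : ℕ)) * u i < (n : ℝ) - countBelow U i ↔ i ∈ U := by
  constructor
  · rintro rfl i
    rw [mem_sample, selectedBefore_eq_countBelow n u i i.2.le]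
  · intro h
    have : ∀ k ≤ N, selectedBefore N n u k = countBelow U k := by
      intro k
      induction k with
      | zero => intro _; rw [countBelow_zero]; rfl
      | succ k ih =>
        intro hk
        have h₁ := countBelow_succ (S := U) ⟨k, hk⟩
        rw [← if_congr (h ⟨k, hk⟩) rfl rfl] at h₁
        rw [h₁, selectedBefore, ih (by omega)]
    ext i
    rw [mem_sample, this i i.2.le, h]

theorem uniformIco_apply (s : Set UnitIco) :
    uniformIco s = MeasureTheory.volume (Subtype.val '' s) := by
  rw [uniformIco, (MeasurableEmbedding.subtype_coe measurableSet_Ico).comap_apply]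

/-- Since the threshold `p / a` is at most 1, the upper end of the unit interval imposes nothing; in
the complementary lemma `0 ≤ p` plays this role at the lower end. -/
theorem uniformIco_lt {a p : ℝ} (ha : 0 < a) (h₁ : p ≤ a) :
    uniformIco {x | a * (x : ℝ) < p} = ENNReal.ofReal (p / a) := by
  have : (Subtype.val '' {x : UnitIco | a * (x : ℝ) < p}) = Set.Ico 0 (p / a) := by
    ext x
    simp only [Set.mem_image, Set.mem_ofPred_eq, Subtype.exists, Set.mem_Ico, exists_and_left,
      exists_prop, exists_eq_right_right]
    rw [lt_div_iff₀' ha]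
    have : a * x < p → x < 1 := fun h => by nlinarith
    tauto
  rw [uniformIco_apply, this, Real.volume_Ico, sub_zero]

theorem uniformIco_not_lt {a p : ℝ} (ha : 0 < a) (h₀ : 0 ≤ p) :
    uniformIco {x | ¬ a * (x : ℝ) < p} = ENNReal.ofReal ((a - p) / a) := by
  have : (Subtype.val '' {x : UnitIco | ¬ a * (x : ℝ) < p}) = Set.Ico (p / a) 1 := by
    ext x
    simp only [Set.mem_image, Set.mem_ofPred_eq, Subtype.exists, Set.mem_Ico, exists_and_left,
      exists_prop, exists_eq_right_right]
    rw [div_le_iff₀' ha, not_lt]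
    have : p ≤ a * x → 0 ≤ x := fun h => by
      by_contra hx
      nlinarith
    tauto
  rw [uniformIco_apply, this, Real.volume_Ico, sub_div, div_self ha.ne']

/-- Downward induction from `N`: the last `k` items contain at most `k` elements of `U`. This keeps
all conditional probabilities between 0 and 1. -/
theorem countBelow_bounds {N : ℕ} (U : Finset (Fin N)) :
    ∀ k ≤ N, countBelow U (N - k) ≤ U.card ∧ U.card ≤ countBelow U (N - k) + k := by
  intro k
  induction k with
  | zero => intro _; rw [Nat.sub_zero, countBelow_card]; omega
  | succ k ih =>
    intro hk
    have h := ih (by omega)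
    have h' := countBelow_succ (S := U) ⟨N - (k + 1), by omega⟩
    simp only [show N - (k + 1) + 1 = N - k by omega] at h'
    split_ifs at h' <;> omega

/-- The probability that sequential selection makes the decisions that lead to `U` is the product
of the conditional probabilities. -/
theorem prod_selection {N n : ℕ} (U : Finset (Fin N)) (hU : U.card = n) (p : ℕ → ℝ)
    (hp : ∀ i : Fin N, p i = (if i ∈ U then (n : ℝ) - countBelow U i
      else (N : ℝ) - i - ((n : ℝ) - countBelow U i)) / ((N : ℝ) - i)) :
    ∏ i ∈ Finset.range N, p i = ((N.choose n : ℝ))⁻¹ := by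
  have hn : n ≤ N := by simpa [hU] using Finset.card_le_univ U
  have hc : (N.choose n : ℝ) ≠ 0 := by exact_mod_cast (Nat.choose_pos hn).ne'
  -- The right side counts the completions of the choices made so far; at `k = N` it is `0.choose 0
  -- = 1`. Each step is one of the two absorption identities for binomial coefficients, according to
  -- whether item `k` is in `U`.
  have key : ∀ k ≤ N, (∏ i ∈ Finset.range k, p i) * N.choose n =
      ((N - k).choose (n - countBelow U k) : ℝ) := by
    intro k
    induction k with
    | zero => intro _; simp [countBelow_zero]
    | succ k ih =>
      intro hk
      have hb := countBelow_bounds U (N - k) (by omega)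
      have hb' := countBelow_bounds U (N - (k + 1)) (by omega)
      rw [show N - (N - k) = k by omega, hU] at hb
      rw [show N - (N - (k + 1)) = k + 1 by omega, hU] at hb'
      have hN : (N : ℝ) - k ≠ 0 := by
        rw [sub_ne_zero]
        exact_mod_cast (show N ≠ k by omega)
      rw [Finset.prod_range_succ, mul_right_comm, ih (by omega), hp ⟨k, hk⟩,
        mul_div_assoc', div_eq_iff hN]
      have hs := countBelow_succ (S := U) ⟨k, hk⟩
      obtain ⟨M, hM⟩ : ∃ M, N - k = M + 1 := ⟨N - (k + 1), by omega⟩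
      have hM' : (N : ℝ) - k = ((M + 1 : ℕ) : ℝ) := by rw [← hM, Nat.cast_sub (by omega)]
      have hM'' : N - (k + 1) = M := by omega
      have hcast : (n : ℝ) - countBelow U k = ((n - countBelow U k : ℕ) : ℝ) := by
        rw [Nat.cast_sub hb.1]
      simp only [hcast, hM', hM, hM'']
      split_ifs at hs ⊢ with h
      · obtain ⟨m, hm⟩ : ∃ m, n - countBelow U k = m + 1 :=
          ⟨n - countBelow U (k + 1), by simp only at hs; omega⟩
        have hm' : n - countBelow U (k + 1) = m := by simp only at hs; omega
        rw [hm, hm', mul_comm _ ((M + 1 : ℕ) : ℝ)]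
        exact_mod_cast (Nat.add_one_mul_choose_eq M m).symm
      · have hm' : n - countBelow U (k + 1) = n - countBelow U k := by simp only at hs; omega
        have hle : n - countBelow U k ≤ M + 1 := by omega
        rw [hm', ← Nat.cast_sub hle]
        exact_mod_cast (Nat.choose_mul_succ_eq M _).symm
  have := key N le_rfl
  rw [countBelow_card, hU] at this
  rw [eq_inv_of_mul_eq_one_left (this.trans ?_)]
  simp

theorem tapeLaw_selectedNodes (N n : ℕ) (U : Finset (Fin N)) (hU : U.card = n) :
    tapeLaw {ω | selectedNodes N n ω = U} = ((N.choose n : ENNReal))⁻¹ := by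
  classical
  -- The guard `i < N` makes `t` total on `ℕ`; only the factors below `N` enter the cylinder set.
  let t : ℕ → Set UnitIco := fun i =>
    {x | ∀ h : i < N, ((N : ℝ) - i) * (x : ℝ) < (n : ℝ) - countBelow U i ↔ (⟨i, h⟩ : Fin N) ∈ U}
  have hset : {ω | selectedNodes N n ω = U} = Set.pi (Finset.range N) t := by
    ext ω
    simp only [Set.mem_ofPred_eq, selectedNodes, sample_eq_iff, Set.mem_pi, Finset.coe_range,
      Set.mem_Iio, t]
    exact ⟨fun h i _ hi => h ⟨i, hi⟩, fun h i => h i i.2 i.2⟩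
  let p : ℕ → ℝ := fun i => if h : i < N then ((if (⟨i, h⟩ : Fin N) ∈ U then
    (n : ℝ) - countBelow U i else (N : ℝ) - i - ((n : ℝ) - countBelow U i)) / ((N : ℝ) - i)) else 0
  have hb : ∀ i < N, (0 : ℝ) < (N : ℝ) - i ∧ (0 : ℝ) ≤ (n : ℝ) - countBelow U i ∧
      (n : ℝ) - countBelow U i ≤ (N : ℝ) - i := by
    intro i hi
    have hb := countBelow_bounds U (N - i) (by omega)
    rw [show N - (N - i) = i by omega, hU] at hb
    refine ⟨?_, ?_, ?_⟩
    · rw [sub_pos, Nat.cast_lt]; exact hi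
    · rw [sub_nonneg, Nat.cast_le]; exact hb.1
    · have h₂ : n + i ≤ N + countBelow U i := by omega
      have h₃ : (n : ℝ) + i ≤ N + countBelow U i := by exact_mod_cast h₂
      linarith
  have hp₀ : ∀ i ∈ Finset.range N, 0 ≤ p i := by
    intro i hi
    have hi := Finset.mem_range.1 hi
    obtain ⟨h₁, h₂, h₃⟩ := hb i hi
    simp only [p, dif_pos hi]
    split_ifs
    exacts [div_nonneg h₂ h₁.le, div_nonneg (sub_nonneg.2 h₃) h₁.le]
  have ht : ∀ i ∈ Finset.range N, uniformIco (t i) = ENNReal.ofReal (p i) := by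
    intro i hi
    have hi := Finset.mem_range.1 hi
    obtain ⟨h₁, h₂, h₃⟩ := hb i hi
    simp only [p, dif_pos hi, t]
    split_ifs with h
    · rw [← uniformIco_lt h₁ h₃]
      simp [hi, h]
    · rw [← uniformIco_not_lt h₁ h₂]
      simp [hi, h]
  have hm : ∀ i ∈ Finset.range N, MeasurableSet (t i) := by
    intro i hi
    have hi := Finset.mem_range.1 hi
    have hm : MeasurableSet {x : UnitIco | ((N : ℝ) - i) * (x : ℝ) < (n : ℝ) - countBelow U i} :=
      measurableSet_lt (measurable_subtype_coe.const_mul _) measurable_const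
    by_cases h : (⟨i, hi⟩ : Fin N) ∈ U
    · simpa [t, hi, h] using hm
    · simpa [t, hi, h, Set.compl_ofPred] using hm.compl
  rw [hset, tapeLaw, MeasureTheory.Measure.infinitePi_pi _ hm, Finset.prod_congr rfl ht,
    ← ENNReal.ofReal_prod_of_nonneg hp₀, prod_selection U hU p fun i => by simp [p],
    ENNReal.ofReal_inv_of_pos, ENNReal.ofReal_natCast]
  have hn : n ≤ N := by simpa [hU] using Finset.card_le_univ U
  exact_mod_cast Nat.choose_pos hn

/-! ### Notation for expressions -/

instance : Add IExp := ⟨.add⟩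
instance : Sub IExp := ⟨.sub⟩
instance : Add RExp := ⟨.bin .add⟩
instance : Sub RExp := ⟨.bin .sub⟩
instance : Mul RExp := ⟨.bin .mul⟩
instance : Div RExp := ⟨.bin .div⟩

/-- Conjunction. -/
def IExp.and (a b : IExp) : IExp := .ite a b (.const 0)

/-- Disjunction. -/
def IExp.or (a b : IExp) : IExp := .ite a (.const 1) b

/-- Negation. -/
def IExp.not (a : IExp) : IExp := .ite a (.const 0) (.const 1)

/-- Comparison. -/
def IExp.le (a b : IExp) : IExp := .not (.lt b a)

/-- Equality. -/
def IExp.eq (a b : IExp) : IExp := .and (.le a b) (.le b a)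

/-- A real expression with value `0` if the condition fails. -/
def RExp.when (c : IExp) (x : RExp) : RExp := .ite c x (.cast (.const 0))

@[simp] theorem pos_ite_one {p : Prop} [Decidable p] : 0 < (if p then 1 else 0 : ℕ) ↔ p := by
  split_ifs with h <;> simp [h]

section Eval

variable (a b : IExp) (x y : RExp) (ρ : List ℕ) (σ : Store)

@[simp] theorem IExp.eval_inp (r : Fin 6) : (IExp.inp r).eval ρ σ = σ.inp r := by rw [IExp.eval]
@[simp] theorem IExp.eval_var_zero (i : ℕ) : (IExp.var 0).eval (i :: ρ) σ = i := by
  simp [IExp.eval]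
@[simp] theorem IExp.eval_var_succ (k i : ℕ) :
    (IExp.var (k + 1)).eval (i :: ρ) σ = (IExp.var k).eval ρ σ := by
  simp [IExp.eval]
@[simp] theorem IExp.eval_var_one (i j : ℕ) : (IExp.var 1).eval (i :: j :: ρ) σ = j := by
  simp [IExp.eval]
@[simp] theorem IExp.eval_var_two (i j k : ℕ) :
    (IExp.var 2).eval (i :: j :: k :: ρ) σ = k := by
  simp [IExp.eval]
@[simp] theorem IExp.eval_const (c : ℕ) : (IExp.const c).eval ρ σ = c := by rw [IExp.eval]
@[simp] theorem IExp.eval_add : (a + b).eval ρ σ = a.eval ρ σ + b.eval ρ σ := by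
  rw [show a + b = IExp.add a b from rfl, IExp.eval]
@[simp] theorem IExp.eval_sub : (a - b).eval ρ σ = a.eval ρ σ - b.eval ρ σ := by
  rw [show a - b = IExp.sub a b from rfl, IExp.eval]
@[simp] theorem IExp.eval_get (c : ℕ) : (IExp.get c a).eval ρ σ = σ.iarr c (a.eval ρ σ) := by
  rw [IExp.eval]
@[simp] theorem IExp.eval_ite (c : IExp) : (IExp.ite c a b).eval ρ σ =
    if 0 < c.eval ρ σ then a.eval ρ σ else b.eval ρ σ := by rw [IExp.eval]
@[simp] theorem IExp.eval_sum (r : Fin 6) : (IExp.sum r a).eval ρ σ =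
    ∑ i ∈ Finset.range (σ.inp r), a.eval (i :: ρ) σ := by rw [IExp.eval]
@[simp] theorem RExp.eval_cast : (RExp.cast a).eval ρ σ = a.eval ρ σ := by rw [RExp.eval]
@[simp] theorem RExp.eval_add : (x + y).eval ρ σ = x.eval ρ σ + y.eval ρ σ := by
  rw [show x + y = RExp.bin .add x y from rfl, RExp.eval, RealOp.fn]
@[simp] theorem RExp.eval_sub : (x - y).eval ρ σ = x.eval ρ σ - y.eval ρ σ := by
  rw [show x - y = RExp.bin .sub x y from rfl, RExp.eval, RealOp.fn]
@[simp] theorem RExp.eval_mul : (x * y).eval ρ σ = x.eval ρ σ * y.eval ρ σ := by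
  rw [show x * y = RExp.bin .mul x y from rfl, RExp.eval, RealOp.fn]
@[simp] theorem RExp.eval_div : (x / y).eval ρ σ = x.eval ρ σ / y.eval ρ σ := by
  rw [show x / y = RExp.bin .div x y from rfl, RExp.eval, RealOp.fn]
@[simp] theorem RExp.eval_sqrt : (RExp.un .sqrt x).eval ρ σ = √(x.eval ρ σ) := by
  rw [RExp.eval, RealFn.fn]
@[simp] theorem RExp.eval_log : (RExp.un .log x).eval ρ σ = Real.log (x.eval ρ σ) := by
  rw [RExp.eval, RealFn.fn]
@[simp] theorem RExp.eval_get (c : ℕ) : (RExp.get c a b).eval ρ σ =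
    σ.varr c (a.eval ρ σ) (b.eval ρ σ) := by rw [RExp.eval]
@[simp] theorem RExp.eval_ite (c : IExp) : (RExp.ite c x y).eval ρ σ =
    if 0 < c.eval ρ σ then x.eval ρ σ else y.eval ρ σ := by rw [RExp.eval]
@[simp] theorem RExp.eval_sum (r : Fin 6) : (RExp.sum r x).eval ρ σ =
    ∑ i ∈ Finset.range (σ.inp r), x.eval (i :: ρ) σ := by rw [RExp.eval]
@[simp] theorem IExp.eval_lt : (IExp.lt a b).eval ρ σ =
    if a.eval ρ σ < b.eval ρ σ then 1 else 0 := by rw [IExp.eval]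
@[simp] theorem IExp.eval_rlt : (IExp.rlt x y).eval ρ σ =
    if x.eval ρ σ < y.eval ρ σ then 1 else 0 := by rw [IExp.eval]
@[simp] theorem IExp.eval_and_pos : 0 < (IExp.and a b).eval ρ σ ↔
    0 < a.eval ρ σ ∧ 0 < b.eval ρ σ := by
  by_cases h : 0 < a.eval ρ σ <;> simp [IExp.and, h]
@[simp] theorem IExp.eval_or_pos : 0 < (IExp.or a b).eval ρ σ ↔
    0 < a.eval ρ σ ∨ 0 < b.eval ρ σ := by
  by_cases h : 0 < a.eval ρ σ <;> simp [IExp.or, h]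
@[simp] theorem IExp.eval_not_pos : 0 < (IExp.not a).eval ρ σ ↔ ¬ 0 < a.eval ρ σ := by
  by_cases h : 0 < a.eval ρ σ <;> simp [IExp.not, h]
@[simp] theorem IExp.eval_lt_pos : 0 < (IExp.lt a b).eval ρ σ ↔ a.eval ρ σ < b.eval ρ σ := by
  by_cases h : a.eval ρ σ < b.eval ρ σ <;> simp [h]
@[simp] theorem IExp.eval_rlt_pos : 0 < (IExp.rlt x y).eval ρ σ ↔ x.eval ρ σ < y.eval ρ σ := by
  by_cases h : x.eval ρ σ < y.eval ρ σ <;> simp [h]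
@[simp] theorem IExp.eval_le_pos : 0 < (IExp.le a b).eval ρ σ ↔ a.eval ρ σ ≤ b.eval ρ σ := by
  rw [IExp.le, IExp.eval_not_pos, IExp.eval_lt_pos, not_lt]
@[simp] theorem IExp.eval_eq_pos : 0 < (IExp.eq a b).eval ρ σ ↔ a.eval ρ σ = b.eval ρ σ := by
  rw [IExp.eq, IExp.eval_and_pos, IExp.eval_le_pos, IExp.eval_le_pos, le_antisymm_iff]
@[simp] theorem RExp.eval_when (c : IExp) : (RExp.when c x).eval ρ σ =
    if 0 < c.eval ρ σ then x.eval ρ σ else 0 := by simp [RExp.when]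

end Eval

/-! ### The program

Real arrays: `0` network, `1`, `2`, `3` draws, `4` subsampled matrix, `5` right block, `6` block to
be orthonormalised, `7` orthogonal columns, `8` left vectors, `9`, `10` buffers, `11` points, `12`
degree parameters, `13` centres, `14` distances, `15` buffer, `16` edge counts, `17` pair counts,
`18` negative criterion.  Index arrays: `0` sampling of the nodes, `1` list of selected nodes, `2`
sampling of the starting centres, `3` labels, `4` cluster sizes, `5` result. -/

/-- Fill the entries below the bounds `b` and `c` of a real array with random draws. -/
def Stmt.fillDraw (a : ℕ) (b c : Fin 6) : Stmt := .loop b (.loop c (.draw a (.var 1) (.var 0)))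

/-- Sequential selection: number of selected items among the first ones. -/
def selectStmt (a : ℕ) (u m : RExp) : Stmt :=
  .seq (.setI a (.const 0) (.const 0))
    (.loop 0 (.setI a (.var 0 + .const 1) (.get a (.var 0) +
      .rlt ((.cast (.inp 0) - .cast (.var 0)) * u) (m - .cast (.get a (.var 0))))))

/-- The condition that an item is selected. -/
def selectedExp (a : ℕ) (i : IExp) : IExp := .get a (i + .const 1) - .get a i

/-- List of the selected nodes. -/
def listStmt : Stmt :=
  .fillI 1 1 (.sum 0 (.ite (.and (selectedExp 0 (.var 0)) (.eq (.get 0 (.var 0)) (.var 1)))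
    (.var 0) (.const 0)))

def subMatrixStmt : Stmt := .fillR 4 0 1 (.get 0 (.var 1) (.get 1 (.var 0)))

def startBlockStmt : Stmt :=
  .fillR 5 1 2 (.cast (.const 2) * .get 2 (.var 1) (.var 0) - .cast (.const 1))

def mulStmt : Stmt :=
  .fillR 6 0 2 (.sum 1 (.get 4 (.var 2) (.var 0) * .get 5 (.var 0) (.var 1)))

/-- Applying `Aᵀ` first and `A` afterwards avoids the N × N matrix `A Aᵀ`, whose formation would
nest two loops over all nodes. -/
def transposeMulStmt : Stmt :=
  .fillR 5 1 2 (.sum 0 (.get 4 (.var 0) (.var 2) * .get 8 (.var 0) (.var 1)))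

/-- The coefficients are stored because evaluating them inside the column update would nest a sum
over nodes in a loop over nodes. The one-row array uses register 5, which holds 1, as row bound. -/
def gsCoeffStmt : Stmt :=
  .fillR 9 5 2 ((.sum 0 (.get 7 (.var 0) (.var 1) * .get 6 (.var 0) (.var 3))) /
      (.sum 0 (.get 7 (.var 0) (.var 1) * .get 7 (.var 0) (.var 1))))

/-- Variable 2 is the round: its column is orthogonalised, and all others are carried over to the
buffer unchanged. -/
def gsColumnStmt : Stmt :=
  .fillR 10 0 2 (.ite (.eq (.var 0) (.var 2))
    (.get 6 (.var 1) (.var 2) - .sum 2 (.when (.lt (.var 0) (.var 3))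
      (.get 9 (.const 0) (.var 0) * .get 7 (.var 2) (.var 0))))
    (.get 7 (.var 1) (.var 0)))

def gsCopyStmt : Stmt := .fillR 7 0 2 (.get 10 (.var 1) (.var 0))

def gsNormStmt : Stmt :=
  .fillR 9 5 2 (.un .sqrt (.sum 0 (.get 7 (.var 0) (.var 1) * .get 7 (.var 0) (.var 1))))

def gsNormaliseStmt : Stmt :=
  .fillR 8 0 2 (.get 7 (.var 1) (.var 0) / .get 9 (.const 0) (.var 0))

def orthStmt : Stmt :=
  .seq (.loop 2 (.seq gsCoeffStmt (.seq gsColumnStmt gsCopyStmt)))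
    (.seq gsNormStmt gsNormaliseStmt)

def svdStmt : Stmt :=
  .seq startBlockStmt (.seq (.seq mulStmt orthStmt)
    (.loop 3 (.seq transposeMulStmt (.seq mulStmt orthStmt))))

/-- The smallest minimiser of a row of a real array below a bound; `K s` is the bound under `s`
binders. -/
def argminExp (a r : ℕ) (K : ℕ → IExp) : IExp :=
  .sum 2 (.ite (.sum 2 (.ite (.and (.le (.var 0) (.var 1)) (.and (.lt (.var 0) (K 2)) (.not
    (.sum 2 (.ite (.and (.lt (.var 0) (K 3))
      (.rlt (.get a (.var (r + 3)) (.var 0)) (.get a (.var (r + 3)) (.var 1))))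
      (.const 1) (.const 0)))))) (.const 1) (.const 0))) (.const 0) (.const 1))

def pointsStmt : Model → Stmt
  | .sbm => .fillR 11 0 2 (.get 8 (.var 1) (.var 0))
  | .dcsbm => .seq
      (.fillR 12 5 0 (.un .sqrt (.sum 2 (.when (.lt (.var 0) (.var 3 + .const 1))
        (.get 8 (.var 1) (.var 0) * .get 8 (.var 1) (.var 0))))))
      (.fillR 11 0 2 (.get 8 (.var 1) (.var 0) / .get 12 (.const 0) (.var 1)))

def startCentresStmt : Stmt :=
  .fillR 13 2 2 (.sum 0 (.when
    (.and (selectedExp 2 (.var 0)) (.eq (.get 2 (.var 0)) (.var 2))) (.get 11 (.var 0) (.var 1))))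

/-- `s` is the number of loops between the candidate loop and this statement: 1 inside a Lloyd
round, 0 for the final labels. -/
def distStmt (s : ℕ) : Stmt :=
  .fillR 14 0 2 (.un .sqrt (.sum 2 (.when (.lt (.var 0) (.var (s + 3) + .const 1))
    ((.get 11 (.var 2) (.var 0) - .get 13 (.var 1) (.var 0)) *
      (.get 11 (.var 2) (.var 0) - .get 13 (.var 1) (.var 0))))))

def labelStmt (s : ℕ) : Stmt :=
  .seq (distStmt s) (.fillI 3 0 (argminExp 14 0 (fun t => .var (s + 1 + t) + .const 1)))

def sizeStmt : Stmt :=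
  .fillI 4 2 (.sum 0 (.ite (.eq (.get 3 (.var 0)) (.var 1)) (.const 1) (.const 0)))

/-- The cluster size itself serves as truth value, so an empty cluster keeps its centre. -/
def meanStmt : Stmt :=
  .fillR 15 2 2 (.ite (.get 4 (.var 1))
    ((.sum 0 (.when (.eq (.get 3 (.var 0)) (.var 2)) (.get 11 (.var 0) (.var 1)))) /
      .cast (.get 4 (.var 1)))
    (.get 13 (.var 1) (.var 0)))

def centreCopyStmt : Stmt := .fillR 13 2 2 (.get 15 (.var 1) (.var 0))

def kmeansStmt : Stmt :=
  .seq startCentresStmt (.seq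
    (.loop 4 (.seq (labelStmt 1) (.seq sizeStmt (.seq meanStmt centreCopyStmt))))
    (labelStmt 0))

/-- The condition for a pair of the subsample: the row `i` and the `t`-th selected node. -/
def pairExp : IExp :=
  .not (.and (selectedExp 0 (.var 1)) (.not (.lt (.var 1) (.get 1 (.var 0)))))

/-- The condition that a pair joins the communities `k` and `l`. -/
def joinsExp : IExp :=
  .or (.and (.eq (.get 3 (.var 1)) (.var 3)) (.eq (.get 3 (.get 1 (.var 0))) (.var 2)))
    (.and (.eq (.get 3 (.var 1)) (.var 2)) (.eq (.get 3 (.get 1 (.var 0))) (.var 3)))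

def betweenExp (F : RExp) : RExp :=
  .sum 0 (.sum 1 (.when (.and pairExp joinsExp) F))

def edgeCountStmt : Stmt := .fillR 16 2 2 (betweenExp (.get 4 (.var 1) (.var 0)))

def weightExp : Model → RExp
  | .sbm => .cast (.const 1)
  | .dcsbm => .get 12 (.const 0) (.var 1) * .get 12 (.const 0) (.get 1 (.var 0))

def weightStmt (model : Model) : Stmt := .fillR 17 2 2 (betweenExp (weightExp model))

def labelPairsExp (F : RExp) : RExp :=
  .sum 2 (.sum 2 (.when (.and (.le (.var 1) (.var 0)) (.lt (.var 0) (.var 2 + .const 1))) F))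

def edgesExp : RExp := .get 16 (.var 1) (.var 0)

def weightsExp : RExp := .get 17 (.var 1) (.var 0)

def logLikExp : Model → RExp
  | .sbm => labelPairsExp (edgesExp * .un .log (edgesExp / weightsExp) +
      (weightsExp - edgesExp) * .un .log (.cast (.const 1) - edgesExp / weightsExp))
  | .dcsbm => .sum 0 (.sum 1 (.when pairExp (.get 4 (.var 1) (.var 0) *
      .un .log (.get 12 (.const 0) (.var 1) * .get 12 (.const 0) (.get 1 (.var 0)))))) +
      labelPairsExp (edgesExp * .un .log (edgesExp / weightsExp) -
        weightsExp * (edgesExp / weightsExp))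

def penaltyExp : RExp :=
  .cast (.inp 1) * .un .log (.cast (.var 0 + .const 1)) +
    .cast (.var 0 + .const 1) * (.cast (.var 0 + .const 1) + .cast (.const 1)) / .cast (.const 4) *
      .un .log (.cast (.inp 0) * .cast (.inp 1) -
        .cast (.inp 1) * (.cast (.inp 1) + .cast (.const 1)) / .cast (.const 2))

/-- Evaluation of one candidate; the loop variable is the candidate minus one. -/
def candidateStmt (model : Model) : Stmt :=
  .seq (selectStmt 2 (.get 3 (.var 1) (.var 0)) (.cast (.var 1 + .const 1)))
    (.seq (pointsStmt model) (.seq kmeansStmt (.seq edgeCountStmt (.seq (weightStmt model)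
      (.setR 18 (.const 0) (.var 0) (penaltyExp - logLikExp model))))))

/-- All draws, then the sampling of the nodes and the truncated singular value decomposition. -/
def prepareStmt : Stmt :=
  .seq (.seq (.fillDraw 1 5 0) (.seq (.fillDraw 2 1 2) (.fillDraw 3 2 0)))
    (.seq (selectStmt 0 (.get 1 (.const 0) (.var 0)) (.cast (.inp 1)))
      (.seq listStmt (.seq subMatrixStmt svdStmt)))

/-- The criterion is stored with the opposite sign, so the code for minimisers also finds its
maximiser. -/
def bicStmt (model : Model) : Stmt :=
  .seq prepareStmt (.seq (.loop 2 (candidateStmt model))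
    (.fillI 5 5 (argminExp 18 0 (fun _ => .inp 2))))

/-- The program: the constant register is set, the high-level code is run, and the result is copied
to the output register. -/
def bicProgram (model : Model) : Program :=
  .seq (.act (.iconst 5 1)) (.seq ((bicStmt model).comp 6 []) (.seq (.act (.iconst 6 0))
    (.seq (.act (.iload 0 5 6)) (.seq (.act (.iconst 6 1)) (.act (.iadd 0 0 6))))))

/-- The content of the O(N n) bound: no loop or sum over all nodes lies inside another one, and
likewise for the selected nodes. This is a finite check on the syntax. -/
theorem bicStmt_deg (model : Model) :
    (bicStmt model).deg 0 = 1 ∧ (bicStmt model).deg 1 = 1 := by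
  cases model <;> exact ⟨by decide, by decide⟩

/-! ### Semantics of the parts of the program -/

/-- The contents of the input registers. -/
def inputs (N n L q T : ℕ) : Fin 6 → ℕ := ![N, n, L, q, T, 1]

@[simp] theorem inputs_zero (N n L q T : ℕ) : inputs N n L q T 0 = N := rfl
@[simp] theorem inputs_one (N n L q T : ℕ) : inputs N n L q T 1 = n := rfl
@[simp] theorem inputs_two (N n L q T : ℕ) : inputs N n L q T 2 = L := rfl
@[simp] theorem inputs_four (N n L q T : ℕ) : inputs N n L q T 4 = T := rfl
@[simp] theorem inputs_five (N n L q T : ℕ) : inputs N n L q T 5 = 1 := rfl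

/-- Draws are stored row by row, which produces the tape offsets used for the starting block and the
starting centres. -/
theorem Stmt.exec_fillDraw (ω : Tape) (a : ℕ) (b c : Fin 6) (ρ : List ℕ) (σ : Store) :
    ((Stmt.fillDraw a b c).exec ω ρ σ).draws = σ.draws + σ.inp b * σ.inp c ∧
      ∀ i < σ.inp b, ∀ j < σ.inp c, ((Stmt.fillDraw a b c).exec ω ρ σ).varr a i j =
        ω (σ.draws + i * σ.inp c + j) := by
  refine Stmt.exec_loop (ω := ω) (b := b) (s := .loop c (.draw a (.var 1) (.var 0))) (ρ := ρ)
    (σ := σ) (fun k τ => τ.draws = σ.draws + k * σ.inp c ∧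
      ∀ i < k, ∀ j < σ.inp c, τ.varr a i j = ω (σ.draws + i * σ.inp c + j))
    ⟨by simp, by simp⟩ ?_
  rintro k τ hk hτ ⟨h, h'⟩
  have := Stmt.exec_loop (ω := ω) (b := c) (s := .draw a (.var 1) (.var 0)) (ρ := k :: ρ)
    (σ := τ) (fun l υ => υ.draws = σ.draws + k * σ.inp c + l ∧
      (∀ i < k, ∀ j < σ.inp c, υ.varr a i j = ω (σ.draws + i * σ.inp c + j)) ∧
      ∀ j < l, υ.varr a k j = ω (σ.draws + k * σ.inp c + j)) ⟨h, h', by simp⟩ ?_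
  · rw [hτ] at this
    refine ⟨by rw [this.1, add_mul, one_mul, add_assoc], fun i hi j hj => ?_⟩
    rcases Nat.lt_succ_iff_lt_or_eq.1 hi with hi | rfl
    exacts [this.2.1 i hi j hj, this.2.2 j hj]
  · rintro l υ hl hυ ⟨g, g', g''⟩
    refine ⟨by simp [Stmt.exec, g, add_assoc], fun i hi j hj => ?_, fun j hj => ?_⟩
    · simp [Stmt.exec, Store.setR, hi.ne, g' i hi j hj]
    · rcases eq_or_ne j l with rfl | hjl
      · simp [Stmt.exec, Store.setR, g]
      · simp [Stmt.exec, Store.setR, hjl, g'' j (by omega)]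

theorem exec_selectStmt {ω : Tape} {a N m : ℕ} {u e : RExp} {ρ : List ℕ} {σ : Store} {U : ℕ → ℝ}
    (hN : σ.inp 0 = N)
    (hu : ∀ i τ, i < N → τ.inp = σ.inp → τ.varr = σ.varr → u.eval (i :: ρ) τ = U i)
    (he : ∀ i τ, τ.inp = σ.inp → e.eval (i :: ρ) τ = m) {k : ℕ} (hk : k ≤ N) :
    ((selectStmt a u e).exec ω ρ σ).iarr a k = selectedBefore N m U k := by
  subst hN
  rw [selectStmt, Stmt.exec]
  have := Stmt.exec_loop (ω := ω) (b := 0) (s := .setI a (.var 0 + .const 1) (.get a (.var 0) +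
      .rlt ((.cast (.inp 0) - .cast (.var 0)) * u) (e - .cast (.get a (.var 0))))) (ρ := ρ)
    (σ := (Stmt.setI a (.const 0) (.const 0)).exec ω ρ σ)
    (fun k τ => τ.varr = σ.varr ∧ ∀ i ≤ k, τ.iarr a i = selectedBefore (σ.inp 0) m U i) ?_ ?_
  · exact this.2 k hk
  · refine ⟨rfl, fun i hi => ?_⟩
    obtain rfl : i = 0 := by omega
    simp [Stmt.exec, Store.setI, selectedBefore]
  · rintro k τ hk hτ ⟨h, h'⟩
    rw [Stmt.exec_inp] at hτ hk
    refine ⟨h, fun i hi => ?_⟩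
    rcases Nat.le_succ_iff.1 hi with hi | rfl
    · have : i ≠ k + 1 := by omega
      simp [Stmt.exec, Store.setI, this, h' i hi]
    · simp [Stmt.exec, Store.setI, hu k τ hk hτ h, he k τ hτ, h' k le_rfl, hτ, selectedBefore]

/-- Index array `a` holds the numbers of elements of `R` among the first nodes. -/
def HasCounts {N : ℕ} (σ : Store) (a : ℕ) (R : Finset (Fin N)) : Prop :=
  ∀ k ≤ N, σ.iarr a k = countBelow R k

/-- Index array `1` lists the elements of `S`. -/
def HasList {N : ℕ} (σ : Store) (S : Finset (Fin N)) : Prop :=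
  ∀ j ∈ S, σ.iarr 1 (position S j) = (j : ℕ)

theorem HasCounts.position {N : ℕ} {σ : Store} {a : ℕ} {R : Finset (Fin N)}
    (h : HasCounts σ a R) (i : Fin N) : σ.iarr a i = position R i := h i i.2.le

theorem HasCounts.selected {N : ℕ} {σ : Store} {a : ℕ} {R : Finset (Fin N)}
    (h : HasCounts σ a R) {i : Fin N} {e : IExp} {ρ : List ℕ} (he : e.eval ρ σ = i) :
    0 < (selectedExp a e).eval ρ σ ↔ i ∈ R := by
  simp only [selectedExp, IExp.eval_sub, IExp.eval_get, IExp.eval_add, IExp.eval_const, he]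
  rw [h _ i.2, h _ i.2.le, countBelow_succ]
  split_ifs with hi <;> simp [hi]

/-- A real array holds the matrix `Y`. -/
def HasMatrix {N K : ℕ} (σ : Store) (a : ℕ) (Y : Fin N → Fin K → ℝ) : Prop :=
  ∀ (i : Fin N) (k : Fin K), σ.varr a i k = Y i k

/-- A real array holds the matrix `Z`, whose rows are indexed by a set of nodes. -/
def HasRows {N K : ℕ} (S : Finset (Fin N)) (σ : Store) (a : ℕ) (Z : Matrix S (Fin K) ℝ) : Prop :=
  ∀ (j : S) (k : Fin K), σ.varr a (position S j) k = Z j k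

/-- Real array `4` holds the subsampled matrix. -/
def HasColumns {N : ℕ} (S : Finset (Fin N)) (σ : Store) (A : Matrix (Fin N) (Fin N) ℝ) : Prop :=
  ∀ (i : Fin N), ∀ j ∈ S, σ.varr 4 i (position S j) = A i j

section

variable {ω : Tape} {N n L q T : ℕ} {ρ : List ℕ} {σ : Store} {S : Finset (Fin N)}

/-- Exactly one selected node has a given position, so the sum over all nodes reduces to that node's
index. -/
theorem exec_listStmt (hin : σ.inp = inputs N n L q T) (hS : S.card = n) (h : HasCounts σ 0 S) :
    HasList (listStmt.exec ω ρ σ) S := by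
  intro j hj
  have hj' := position_lt_card hj
  rw [listStmt, Stmt.exec_fillI (by decide) _ _ (by simpa [hin, hS] using hj')]
  simp only [IExp.eval_sum, hin, inputs_zero, Finset.sum_range]
  rw [Finset.sum_eq_single j]
  · simp [h.selected (i := j), hj, h.position]
  · intro i _ hij
    have : ¬ (i ∈ S ∧ position S i = position S j) := fun hi => hij (position_injOn hi.1 hj hi.2)
    simpa [h.selected (i := i), h.position] using fun h₁ h₂ => absurd ⟨h₁, h₂⟩ this
  · simp

theorem exec_subMatrixStmt (hin : σ.inp = inputs N n L q T) (hS : S.card = n) (h : HasList σ S)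
    {A : Matrix (Fin N) (Fin N) ℝ} (hA : HasMatrix σ 0 A) :
    HasColumns S (subMatrixStmt.exec ω ρ σ) A := by
  intro i j hj
  have hj' := position_lt_card hj
  rw [subMatrixStmt, Stmt.exec_fillR (by decide) _ _ (by simp [hin])
    (by simpa [hin, hS] using hj')]
  simp [h j hj, hA i j]

theorem exec_startBlockStmt (hin : σ.inp = inputs N n L q T) (hS : S.card = n)
    (hX : ∀ j < n, ∀ k < L, σ.varr 2 j k = ω (N + j * L + k)) :
    HasRows S (startBlockStmt.exec ω ρ σ) 5 (startBlock L L S ω) := by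
  intro j k
  have hj := position_lt_card j.2
  rw [startBlockStmt, Stmt.exec_fillR (by decide) _ _ (by simpa [hin, hS] using hj)
    (by simp [hin])]
  simp [hX _ (hS ▸ hj) _ k.2, startBlock]

theorem exec_mulStmt (hin : σ.inp = inputs N n L q T) (hS : S.card = n)
    {A : Matrix (Fin N) (Fin N) ℝ} (hA : HasColumns S σ A) {Z : Matrix S (Fin L) ℝ}
    (hZ : HasRows S σ 5 Z) : HasMatrix (mulStmt.exec ω ρ σ) 6 (subMatrix A S * Z) := by
  intro i k
  rw [mulStmt, Stmt.exec_fillR (by decide) _ _ (by simp [hin]) (by simp [hin])]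
  simp only [RExp.eval_sum, hin, inputs_one, ← hS]
  rw [sum_position, Matrix.mul_apply, ← Finset.sum_coe_sort S]
  refine Finset.sum_congr rfl fun j _ => ?_
  simp [hA i j j.2, hZ j k, subMatrix]

theorem exec_transposeMulStmt (hin : σ.inp = inputs N n L q T) (hS : S.card = n)
    {A : Matrix (Fin N) (Fin N) ℝ} (hA : HasColumns S σ A) {V : Matrix (Fin N) (Fin L) ℝ}
    (hV : HasMatrix σ 8 V) :
    HasRows S (transposeMulStmt.exec ω ρ σ) 5 ((subMatrix A S).transpose * V) := by
  intro j k
  have hj := position_lt_card j.2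
  rw [transposeMulStmt, Stmt.exec_fillR (by decide) _ _ (by simpa [hin, hS] using hj)
    (by simp [hin])]
  simp only [RExp.eval_sum, hin, inputs_zero, Finset.sum_range, Matrix.mul_apply]
  refine Finset.sum_congr rfl fun i _ => ?_
  simp [hA i j j.2, hV i k, subMatrix]

theorem exec_gsStep (hin : σ.inp = inputs N n L q T) {Y : Matrix (Fin N) (Fin L) ℝ}
    (hY : HasMatrix σ 6 Y) (k : Fin L)
    (hG : ∀ l < k, ∀ i : Fin N, σ.varr 7 i l = gsEntry Y l i) :
    ∀ l ≤ k, ∀ i : Fin N,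
      ((Stmt.seq gsCoeffStmt (.seq gsColumnStmt gsCopyStmt)).exec ω (k :: ρ) σ).varr 7 i l =
        gsEntry Y l i := by
  intro l hl i
  simp only [Stmt.exec]
  set σ₁ := gsCoeffStmt.exec ω (k :: ρ) σ with hσ₁
  have hin₁ : σ₁.inp = inputs N n L q T := by simp [hσ₁, hin]
  have hf₆ : σ₁.varr 6 = σ.varr 6 := Stmt.exec_varr rfl _ _
  have hf₇ : σ₁.varr 7 = σ.varr 7 := Stmt.exec_varr rfl _ _
  -- Only columns before `k` are known to be orthogonalised; the other computed coefficients are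
  -- masked in the column update.
  have h₉ : ∀ l < k, σ₁.varr 9 0 l = (∑ r, gsEntry Y l r * Y r k) /
      (∑ r, gsEntry Y l r * gsEntry Y l r) := by
    intro l hl
    rw [hσ₁, gsCoeffStmt, Stmt.exec_fillR (by decide) _ _ (by simp [hin]) (by simp [hin])]
    simp [hin, Finset.sum_range, hG l hl, hY _ _]
  rw [gsCopyStmt, Stmt.exec_fillR (by decide) _ _ (by simp [hin₁]) (by simp [hin₁])]
  simp only [RExp.eval_get, IExp.eval_var_one, IExp.eval_var_zero]
  rw [gsColumnStmt, Stmt.exec_fillR (by decide) _ _ (by simp [hin₁]) (by simp [hin₁])]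
  rcases hl.lt_or_eq with hl | rfl
  · have : (l : ℕ) ≠ k := fun h => hl.ne (Fin.ext h)
    simp [this, hf₇, hG l hl]
  · rw [gsEntry_eq]
    simp only [RExp.eval_ite, IExp.eval_eq_pos, IExp.eval_var_zero, IExp.eval_var_two, if_true,
      RExp.eval_sub, RExp.eval_get, IExp.eval_var_one, hf₆, hY i l, RExp.eval_sum, hin₁, inputs_two,
      Finset.sum_range]
    congr 1
    refine Finset.sum_congr rfl fun l' _ => ?_
    by_cases h : l' < l
    · simp [h, h₉ l' h, hf₇, hG l' h]
    · simp [h]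

theorem exec_orthStmt (hin : σ.inp = inputs N n L q T) {Y : Matrix (Fin N) (Fin L) ℝ}
    (hY : HasMatrix σ 6 Y) : HasMatrix (orthStmt.exec ω ρ σ) 8 (orthColumns Y) := by
  intro i k
  rw [orthStmt, Stmt.exec, Stmt.exec]
  set σ₁ := (Stmt.loop 2 (.seq gsCoeffStmt (.seq gsColumnStmt gsCopyStmt))).exec ω ρ σ with hσ₁
  have hin₁ : σ₁.inp = inputs N n L q T := by simp [hσ₁, hin]
  have h₇ : ∀ l : Fin L, ∀ i : Fin N, σ₁.varr 7 i l = gsEntry Y l i := by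
    have := Stmt.exec_loop (ω := ω) (b := 2) (s := .seq gsCoeffStmt (.seq gsColumnStmt gsCopyStmt))
      (ρ := ρ) (σ := σ) (fun k τ => HasMatrix τ 6 Y ∧
        ∀ l : Fin L, (l : ℕ) < k → ∀ i : Fin N, τ.varr 7 i l = gsEntry Y l i)
      ⟨hY, by simp⟩ ?_
    · exact fun l => this.2 l (by simp [hin])
    · rintro k τ hk hτ ⟨h, h'⟩
      have hk' : k < L := by simpa [hin] using hk
      refine ⟨fun i j => ?_, fun l hl => ?_⟩
      · rw [Stmt.exec_varr rfl]
        exact h i j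
      · exact exec_gsStep (hτ.trans hin) h ⟨k, hk'⟩ (fun l hl => h' l hl) l (Nat.lt_succ_iff.1 hl)
  set σ₂ := gsNormStmt.exec ω ρ σ₁ with hσ₂
  have hin₂ : σ₂.inp = inputs N n L q T := by simp [hσ₂, hin₁]
  have hf₇ : σ₂.varr 7 = σ₁.varr 7 := Stmt.exec_varr rfl _ _
  have h₉ : σ₂.varr 9 0 k = √(∑ r, gsEntry Y k r * gsEntry Y k r) := by
    rw [hσ₂, gsNormStmt, Stmt.exec_fillR (by decide) _ _ (by simp [hin₁]) (by simp [hin₁])]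
    simp [hin₁, Finset.sum_range, h₇]
  rw [gsNormaliseStmt, Stmt.exec_fillR (by decide) _ _ (by simp [hin₂]) (by simp [hin₂]),
    orthColumns_eq]
  simp [hf₇, h₇, h₉]

theorem exec_mulOrth (hin : σ.inp = inputs N n L q T) (hS : S.card = n)
    {A : Matrix (Fin N) (Fin N) ℝ} (hA : HasColumns S σ A) {Z : Matrix S (Fin L) ℝ}
    (hZ : HasRows S σ 5 Z) : HasMatrix ((Stmt.seq mulStmt orthStmt).exec ω ρ σ) 8
      (orthColumns (subMatrix A S * Z)) :=
  exec_orthStmt ((Stmt.exec_inp _ _ _ _).trans hin) (exec_mulStmt hin hS hA hZ)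

theorem exec_svdStmt (hin : σ.inp = inputs N n L q T) (hS : S.card = n)
    {A : Matrix (Fin N) (Fin N) ℝ} (hA : HasColumns S σ A)
    (hX : ∀ j < n, ∀ k < L, σ.varr 2 j k = ω (N + j * L + k)) :
    HasMatrix (svdStmt.exec ω ρ σ) 8 (leftVectors (subMatrix A S) (startBlock L L S ω) q) := by
  simp only [svdStmt]
  rw [Stmt.exec, Stmt.exec]
  set σ₁ := startBlockStmt.exec ω ρ σ with hσ₁
  set σ₂ := (Stmt.seq mulStmt orthStmt).exec ω ρ σ₁ with hσ₂
  have hin₁ : σ₁.inp = inputs N n L q T := by simp [hσ₁, hin]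
  have hin₂ : σ₂.inp = inputs N n L q T := by simp [hσ₂, hin₁]
  have h₁ : HasColumns S σ₁ A := fun i j hj => by
    rw [hσ₁, Stmt.exec_varr rfl]; exact hA i j hj
  have h₂ : HasColumns S σ₂ A := fun i j hj => by
    rw [hσ₂, Stmt.exec_varr rfl]; exact h₁ i j hj
  have := Stmt.exec_loop (ω := ω) (b := 3)
    (s := .seq transposeMulStmt (.seq mulStmt orthStmt)) (ρ := ρ) (σ := σ₂)
    (fun k τ => HasColumns S τ A ∧
      HasMatrix τ 8 (leftVectors (subMatrix A S) (startBlock L L S ω) k))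
    ⟨h₂, exec_mulOrth hin₁ hS h₁ (exec_startBlockStmt hin hS hX)⟩ ?_
  · rw [hin₂] at this
    exact this.2
  · rintro k τ hk hτ ⟨h, h'⟩
    have hin₃ := hτ.trans hin₂
    refine ⟨fun i j hj => ?_, ?_⟩
    · rw [Stmt.exec_varr rfl]; exact h i j hj
    · rw [Stmt.exec]
      refine exec_mulOrth ((Stmt.exec_inp _ _ _ _).trans hin₃) hS (fun i j hj => ?_)
        (exec_transposeMulStmt hin₃ hS h h')
      rw [Stmt.exec_varr rfl]; exact h i j hj

/-! ### Clustering -/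

/-- The array is controlled only below `k₁`; the two guards `K 2` and `K 3` exclude whatever lies
beyond. -/
theorem eval_argminExp {a r : ℕ} {K : ℕ → IExp} {k₁ : ℕ} {d : ℕ → ℝ}
    (hin : σ.inp = inputs N n L q T) (h₁ : 1 ≤ k₁) (h₂ : k₁ ≤ L)
    (hd : ∀ k < k₁, σ.varr a ((IExp.var r).eval ρ σ) k = d k)
    (hK₂ : ∀ x y, (K 2).eval (x :: y :: ρ) σ = k₁)
    (hK₃ : ∀ x y z, (K 3).eval (x :: y :: z :: ρ) σ = k₁) :
    (argminExp a r K).eval ρ σ = sInf {k | k < k₁ ∧ ∀ l < k₁, d k ≤ d l} := by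
  rw [argminExp, IExp.eval_sum]
  simp only [IExp.eval_ite, IExp.eval_const]
  rw [hin, inputs_two]
  refine count_eq_sInf h₁ h₂ d _ ?_
  intro k hk
  simp only [IExp.eval_sum, Finset.sum_pos_iff, hin, inputs_two, Finset.mem_range, IExp.eval_ite,
    IExp.eval_const, pos_ite_one, IExp.eval_and_pos, IExp.eval_not_pos, IExp.eval_lt_pos,
    IExp.eval_le_pos, IExp.eval_rlt_pos, RExp.eval_get, IExp.eval_var_zero,
    IExp.eval_var_succ, hK₂, hK₃, not_exists, not_and, not_lt]
  constructor
  · rintro ⟨k', _, hk', hk₁, h⟩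
    refine ⟨k', hk', hk₁, fun l hl => ?_⟩
    rw [← hd k' hk₁, ← hd l hl]
    exact h l (hl.trans_le h₂) hl
  · rintro ⟨k', hk', hk₁, h⟩
    refine ⟨k', hk₁.trans_le h₂, hk', hk₁, fun l _ hl => ?_⟩
    rw [hd k' hk₁, hd l hl]
    exact h l hl

end

section

variable {ω : Tape} {N n L q T : ℕ} {ρ : List ℕ} {σ : Store} {S : Finset (Fin N)}

/-- Real array `11` holds the points that are clustered. -/
def HasPoints {N K : ℕ} (σ : Store) (p : Fin N → EuclideanSpace ℝ (Fin K)) : Prop :=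
  ∀ (i : Fin N) (d : Fin K), σ.varr 11 i d = p i d

/-- Real array `13` holds the centres. -/
def HasCentres {K : ℕ} (σ : Store) (c : ℕ → EuclideanSpace ℝ (Fin K)) : Prop :=
  ∀ k < K, ∀ d : Fin K, σ.varr 13 k d = c k d

/-- Index array `3` holds the labels. -/
def HasLabels {N : ℕ} (σ : Store) (g : Fin N → ℕ) : Prop := ∀ i : Fin N, σ.iarr 3 i = g i

theorem exec_startCentresStmt {K : ℕ} (hin : σ.inp = inputs N n L q T) (hK : K ≤ L)
    {p : Fin N → EuclideanSpace ℝ (Fin K)} (hp : HasPoints σ p) {R : Finset (Fin N)}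
    (hR : HasCounts σ 2 R) :
    HasCentres (startCentresStmt.exec ω ρ σ) (startCentres p R) := by
  intro k hk d
  rw [startCentresStmt, Stmt.exec_fillR (by decide) _ _ (by simp [hin]; omega)
    (by simp [hin]; omega), startCentres, WithLp.ofLp_sum, Finset.sum_apply,
    ← Finset.filter_univ_mem R, Finset.filter_filter, Finset.sum_filter]
  simp only [RExp.eval_sum, hin, inputs_zero, Finset.sum_range, Finset.filter_univ_mem]
  refine Finset.sum_congr rfl fun i _ => ?_
  simp [hR.selected (i := i), hR.position, hp i d]

/-- `hρ` locates the candidate variable at de Bruijn index `s`. The read condition `h₁` is left to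
the caller, where `s` is a numeral and `decide` applies. -/
theorem exec_labelStmt {K k₁ s : ℕ} (hin : σ.inp = inputs N n L q T) (hk₁ : k₁ + 1 = K)
    (hK : K ≤ L) (hρ : ∀ τ, (IExp.var s).eval ρ τ = k₁) {p : Fin N → EuclideanSpace ℝ (Fin K)}
    (hp : HasPoints σ p) {c : ℕ → EuclideanSpace ℝ (Fin K)} (hc : HasCentres σ c)
    (h₁ : (argminExp 14 0 (fun t => .var (s + 1 + t) + .const 1)).avoids false 3 = true) :
    HasLabels ((labelStmt s).exec ω ρ σ) (fun i => nearest K c (p i)) := by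
  intro i
  rw [labelStmt, Stmt.exec]
  set σ₁ := (distStmt s).exec ω ρ σ with hσ₁
  have hin₁ : σ₁.inp = inputs N n L q T := (Stmt.exec_inp _ _ _ _).trans hin
  rw [Stmt.exec_fillI h₁ _ _ (by simp [hin₁])]
  refine eval_argminExp (k₁ := K) (d := fun k => dist (p i) (c k)) hin₁ (by omega) hK ?_ ?_ ?_
  · intro k hk
    rw [IExp.eval_var_zero, hσ₁, distStmt,
      Stmt.exec_fillR (by rfl) _ _ (by simp [hin]) (by simp [hin]; omega),
      ← dist_eq_of_coords hK (hp i) (hc k hk)]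
    simp [hin, hρ, hk₁]
  · intro x y
    simp [hρ, hk₁]
  · intro x y z
    simp [hρ, hk₁]

theorem exec_lloydStmt {K : ℕ} (hin : σ.inp = inputs N n L q T) (hK : K ≤ L)
    {p : Fin N → EuclideanSpace ℝ (Fin K)} (hp : HasPoints σ p)
    {c : ℕ → EuclideanSpace ℝ (Fin K)} {t : ℕ} (hc : HasCentres σ (lloyd K p c t))
    (hg : HasLabels σ (fun i => nearest K (lloyd K p c t) (p i))) :
    HasCentres ((Stmt.seq sizeStmt (.seq meanStmt centreCopyStmt)).exec ω ρ σ)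
      (lloyd K p c (t + 1)) := by
  intro k hk d
  rw [Stmt.exec, Stmt.exec]
  set σ₁ := sizeStmt.exec ω ρ σ with hσ₁
  have hin₁ : σ₁.inp = inputs N n L q T := (Stmt.exec_inp _ _ _ _).trans hin
  have hf₁₁ : σ₁.varr 11 = σ.varr 11 := Stmt.exec_varr rfl _ _
  have hf₁₃ : σ₁.varr 13 = σ.varr 13 := Stmt.exec_varr rfl _ _
  have hf₃ : σ₁.iarr 3 = σ.iarr 3 := Stmt.exec_iarr rfl _ _
  have h₄ : σ₁.iarr 4 k =
      (Finset.univ.filter (fun i => nearest K (lloyd K p c t) (p i) = k)).card := by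
    rw [hσ₁, sizeStmt, Stmt.exec_fillI (by decide) _ _ (by simp [hin]; omega), Finset.card_filter]
    simp only [IExp.eval_sum, hin, inputs_zero, Finset.sum_range]
    exact Finset.sum_congr rfl fun i _ => by simp [hg i]
  set σ₂ := meanStmt.exec ω ρ σ₁ with hσ₂
  have hin₂ : σ₂.inp = inputs N n L q T := (Stmt.exec_inp _ _ _ _).trans hin₁
  rw [centreCopyStmt, Stmt.exec_fillR (by decide) _ _ (by simp [hin₂]; omega)
    (by simp [hin₂]; omega)]
  simp only [RExp.eval_get, IExp.eval_var_one, IExp.eval_var_zero]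
  rw [hσ₂, meanStmt, Stmt.exec_fillR (by decide) _ _ (by simp [hin₁]; omega)
    (by simp [hin₁]; omega), lloyd]
  simp only [RExp.eval_ite, IExp.eval_get, IExp.eval_var_one, h₄, Nat.pos_iff_ne_zero, ite_not]
  split_ifs with h
  · simp [hf₁₃, hc k hk d]
  · rw [PiLp.smul_apply, WithLp.ofLp_sum, Finset.sum_apply, Finset.sum_filter, smul_eq_mul,
      ← div_eq_inv_mul]
    simp [h₄, hin₁, Finset.sum_range, hf₃, hf₁₁, hg _, hp _ _]

theorem exec_kmeansStmt {K k₁ : ℕ} (hin : σ.inp = inputs N n L q T) (hk₁ : k₁ + 1 = K)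
    (hK : K ≤ L) {p : Fin N → EuclideanSpace ℝ (Fin K)} (hp : HasPoints σ p)
    {R : Finset (Fin N)} (hR : HasCounts σ 2 R) :
    HasLabels (kmeansStmt.exec ω (k₁ :: ρ) σ) (kmeans K T p R) := by
  rw [kmeansStmt, Stmt.exec, Stmt.exec]
  set σ₁ := startCentresStmt.exec ω (k₁ :: ρ) σ with hσ₁
  have hin₁ : σ₁.inp = inputs N n L q T := (Stmt.exec_inp _ _ _ _).trans hin
  have hp₁ : HasPoints σ₁ p := fun i d => by rw [hσ₁, Stmt.exec_varr rfl]; exact hp i d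
  have := Stmt.exec_loop (ω := ω) (b := 4)
    (s := .seq (labelStmt 1) (.seq sizeStmt (.seq meanStmt centreCopyStmt))) (ρ := k₁ :: ρ)
    (σ := σ₁) (fun t τ => HasPoints τ p ∧ HasCentres τ (lloyd K p (startCentres p R) t))
    ⟨hp₁, exec_startCentresStmt hin hK hp hR⟩ ?_
  · rw [hin₁, inputs_four] at this
    exact exec_labelStmt (((Stmt.exec_inp _ _ _ _).trans hin₁)) hk₁ hK (by simp) this.1 this.2
      (by decide)
  · rintro t τ ht hτ ⟨h, h'⟩
    have hin₂ := hτ.trans hin₁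
    refine ⟨fun i d => by rw [Stmt.exec_varr rfl]; exact h i d, ?_⟩
    rw [Stmt.exec]
    refine exec_lloydStmt ((Stmt.exec_inp _ _ _ _).trans hin₂) hK
      (fun i d => by rw [Stmt.exec_varr rfl]; exact h i d)
      (fun k hk d => by rw [Stmt.exec_varr rfl]; exact h' k hk d)
      (exec_labelStmt hin₂ hk₁ hK (by simp) h h' (by decide))

/-! ### Plug-in estimation -/

theorem eval_pairExp (hS : HasCounts σ 0 S) (hl : HasList σ S) (i : Fin N) {j : Fin N}
    (hj : j ∈ S) : 0 < pairExp.eval (position S j :: (i : ℕ) :: ρ) σ ↔ (i ∈ S → i < j) := by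
  rw [pairExp, IExp.eval_not_pos, IExp.eval_and_pos, hS.selected (i := i) (by simp)]
  simp [hl j hj]

/-- The node pairs lie in [N] × S, so a loop over nodes and one over list positions suffice, with
the pair condition as mask. -/
theorem eval_sum_pairs (hin : σ.inp = inputs N n L q T) (hc : S.card = n) {c : IExp} {F : RExp} {f : Fin N → Fin N → ℝ}
    (hF : ∀ (i : Fin N), ∀ j ∈ S, (RExp.when c F).eval (position S j :: (i : ℕ) :: ρ) σ =
      if (i ∈ S → i < j) then f i j else 0) :
    (RExp.sum 0 (.sum 1 (.when c F))).eval ρ σ = ∑ e ∈ pairs S, f e.1 e.2 := by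
  rw [sum_pairs, RExp.eval_sum, hin, inputs_zero, Finset.sum_range]
  refine Finset.sum_congr rfl fun i _ => ?_
  rw [RExp.eval_sum, hin, inputs_one, ← hc, sum_position]
  exact Finset.sum_congr rfl fun j hj => hF i j hj

theorem eval_betweenExp (hin : σ.inp = inputs N n L q T) (hc : S.card = n) (hS : HasCounts σ 0 S)
    (hl : HasList σ S) {g : Fin N → ℕ} (hg : HasLabels σ g) {F : RExp} {f : Fin N → Fin N → ℝ}
    {k l : ℕ} (hF : ∀ (i : Fin N), ∀ j ∈ S,
      F.eval (position S j :: (i : ℕ) :: l :: k :: ρ) σ = f i j) :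
    (betweenExp F).eval (l :: k :: ρ) σ = ∑ e ∈ pairsBetween S g k l, f e.1 e.2 := by
  rw [pairsBetween, Finset.sum_filter, betweenExp]
  refine eval_sum_pairs (f := fun i j => if g i = k ∧ g j = l ∨ g i = l ∧ g j = k then f i j else 0)
    hin hc fun i j hj => ?_
  rw [RExp.eval_when, hF i j hj, ← ite_and]
  refine if_congr ?_ rfl rfl
  rw [IExp.eval_and_pos, eval_pairExp hS hl i hj]
  simp [joinsExp, hl j hj, hg _]

theorem eval_labelPairsExp {K k₁ : ℕ} (hin : σ.inp = inputs N n L q T) (hk₁ : k₁ + 1 = K)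
    (hK : K ≤ L) {F : RExp} {f : ℕ → ℕ → ℝ}
    (hF : ∀ k < K, ∀ l < K, F.eval (l :: k :: k₁ :: ρ) σ = f k l) :
    (labelPairsExp F).eval (k₁ :: ρ) σ = ∑ p ∈ labelPairs K, f p.1 p.2 := by
  rw [labelPairs, Finset.sum_filter, Finset.sum_product, labelPairsExp, RExp.eval_sum, hin,
    inputs_two]
  have hsub : Finset.range K ⊆ Finset.range L := Finset.range_subset_range.2 hK
  have hval : ∀ k l, (RExp.when (.and (.le (.var 1) (.var 0)) (.lt (.var 0) (.var 2 + .const 1)))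
      F).eval (l :: k :: k₁ :: ρ) σ =
        if k ≤ l ∧ l < K then F.eval (l :: k :: k₁ :: ρ) σ else 0 := by
    intro k l
    simp [hk₁]
  simp only [RExp.eval_sum, hin, inputs_two, hval]
  rw [← Finset.sum_subset hsub]
  · refine Finset.sum_congr rfl fun k hk => ?_
    rw [← Finset.sum_subset hsub]
    · refine Finset.sum_congr rfl fun l hl => ?_
      have hl' := Finset.mem_range.1 hl
      simp only [hl', and_true]
      rw [hF k (Finset.mem_range.1 hk) l hl']
    · intro l _ hl
      rw [if_neg fun h => hl (Finset.mem_range.2 h.2)]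
  · intro k _ hk
    refine Finset.sum_eq_zero fun l _ => ?_
    rw [if_neg fun h => hk (Finset.mem_range.2 (h.1.trans_lt h.2))]

theorem eval_penaltyExp {k₁ : ℕ} (hin : σ.inp = inputs N n L q T) :
    penaltyExp.eval (k₁ :: ρ) σ = penalty N n (k₁ + 1) := by
  simp [penaltyExp, penalty, hin]

end

-- Shared data, one candidate, and the maximisation.

/-- The store after the sampling and the truncated singular value decomposition. -/
structure Prepared {N : ℕ} (n L q T : ℕ) (A : Matrix (Fin N) (Fin N) ℝ) (ω : Tape) (σ : Store) :
    Prop where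
  inp : σ.inp = inputs N n L q T
  counts : HasCounts σ 0 (selectedNodes N n ω)
  list : HasList σ (selectedNodes N n ω)
  columns : HasColumns (selectedNodes N n ω) σ A
  vectors : HasMatrix σ 8 (leftVectors (subMatrix A (selectedNodes N n ω))
    (startBlock L L (selectedNodes N n ω) ω) q)
  tape : ∀ k < L, ∀ i < N, σ.varr 3 k i = ω (N + n * L + k * N + i)

section

variable {ω : Tape} {N n L q T : ℕ} {ρ : List ℕ} {σ : Store} {A : Matrix (Fin N) (Fin N) ℝ}

/-- A frame rule: the shared data survive any code that does not write to these five arrays. -/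
theorem Prepared.exec (h : Prepared n L q T A ω σ) {s : Stmt}
    (hs : (s.writesI 0 || s.writesI 1 || s.writesR 3 || s.writesR 4 || s.writesR 8) = false) :
    Prepared n L q T A ω (s.exec ω ρ σ) := by
  simp only [Bool.or_eq_false_iff] at hs
  obtain ⟨⟨⟨⟨h₀, h₁⟩, h₃⟩, h₄⟩, h₈⟩ := hs
  refine ⟨(Stmt.exec_inp _ _ _ _).trans h.inp, fun k hk => ?_, fun j hj => ?_, fun i j hj => ?_,
    fun i k => ?_, fun k hk i hi => ?_⟩
  · rw [Stmt.exec_iarr h₀]; exact h.counts k hk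
  · rw [Stmt.exec_iarr h₁]; exact h.list j hj
  · rw [Stmt.exec_varr h₄]; exact h.columns i j hj
  · rw [Stmt.exec_varr h₈]; exact h.vectors i k
  · rw [Stmt.exec_varr h₃]; exact h.tape k hk i hi

theorem Prepared.embedding (h : Prepared n L q T A ω σ) {K : ℕ} (hK : K ≤ L) (i : Fin N)
    (d : Fin K) : σ.varr 8 i d = embedding A (selectedNodes N n ω) L q ω K i d := by
  have := h.vectors i (Fin.castLE hK d)
  -- The starting block of candidate `K` is a prefix of the full one by definition, since both use
  -- the row stride `L`.
  rw [← leftVectors_castLE hK _ (X := startBlock L K (selectedNodes N n ω) ω)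
    (fun _ _ => rfl)] at this
  exact this

theorem card_selectedNodes (hn : n ≤ N) : (selectedNodes N n ω).card = n :=
  card_sample hn (fun i => (ω i).2.1) (fun i => (ω i).2.2)

/-- All draws are made first, in three blocks of sizes N, n L and L N; this fixed layout gives every
candidate its own segment of the tape. -/
theorem exec_prepareStmt (hn : n ≤ N) (hin : σ.inp = inputs N n L q T) (hA : HasMatrix σ 0 A)
    (hd : σ.draws = 0) : Prepared n L q T A ω (prepareStmt.exec ω ρ σ) := by
  have hc : (selectedNodes N n ω).card = n := card_selectedNodes hn
  simp only [prepareStmt]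
  rw [Stmt.exec, Stmt.exec, Stmt.exec, Stmt.exec, Stmt.exec, Stmt.exec]
  set σ₁ := (Stmt.fillDraw 1 5 0).exec ω ρ σ with hσ₁
  set σ₂ := (Stmt.fillDraw 2 1 2).exec ω ρ σ₁ with hσ₂
  set σ₃ := (Stmt.fillDraw 3 2 0).exec ω ρ σ₂ with hσ₃
  obtain ⟨hd₁, hu₁⟩ := Stmt.exec_fillDraw ω 1 5 0 ρ σ
  obtain ⟨hd₂, hu₂⟩ := Stmt.exec_fillDraw ω 2 1 2 ρ σ₁
  obtain ⟨hd₃, hu₃⟩ := Stmt.exec_fillDraw ω 3 2 0 ρ σ₂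
  rw [← hσ₁] at hd₁ hu₁
  rw [← hσ₂] at hd₂ hu₂
  rw [← hσ₃] at hd₃ hu₃
  have hin₁ : σ₁.inp = inputs N n L q T := (Stmt.exec_inp _ _ _ _).trans hin
  have hin₂ : σ₂.inp = inputs N n L q T := (Stmt.exec_inp _ _ _ _).trans hin₁
  have hin₃ : σ₃.inp = inputs N n L q T := (Stmt.exec_inp _ _ _ _).trans hin₂
  simp only [hin, hd, inputs_zero, inputs_five, zero_add, one_mul] at hd₁ hu₁
  simp only [hin₁, hd₁, inputs_one, inputs_two] at hd₂ hu₂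
  simp only [hin₂, hd₂, inputs_zero, inputs_two] at hu₃
  have f₁ : σ₃.varr 1 = σ₁.varr 1 := (Stmt.exec_varr rfl _ _).trans (Stmt.exec_varr rfl _ _)
  have f₂ : σ₃.varr 2 = σ₂.varr 2 := Stmt.exec_varr rfl _ _
  have f₀ : σ₃.varr 0 = σ.varr 0 :=
    (Stmt.exec_varr rfl _ _).trans ((Stmt.exec_varr rfl _ _).trans (Stmt.exec_varr rfl _ _))
  set σ₄ := (selectStmt 0 (.get 1 (.const 0) (.var 0)) (.cast (.inp 1))).exec ω ρ σ₃ with hσ₄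
  have hin₄ : σ₄.inp = inputs N n L q T := (Stmt.exec_inp _ _ _ _).trans hin₃
  have hS : HasCounts σ₄ 0 (selectedNodes N n ω) := by
    intro k hk
    rw [selectedNodes, ← selectedBefore_eq_countBelow n _ k hk, hσ₄]
    refine exec_selectStmt (by simp [hin₃]) (fun i τ hi hτ hτ' => ?_) (fun i τ hτ => ?_) hk
    · simp [hτ', f₁, hu₁ 0 one_pos i hi]
    · simp [hτ, hin₃]
  set σ₅ := listStmt.exec ω ρ σ₄ with hσ₅
  have hin₅ : σ₅.inp = inputs N n L q T := (Stmt.exec_inp _ _ _ _).trans hin₄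
  have hl : HasList σ₅ (selectedNodes N n ω) := exec_listStmt hin₄ hc hS
  set σ₆ := subMatrixStmt.exec ω ρ σ₅ with hσ₆
  have hin₆ : σ₆.inp = inputs N n L q T := (Stmt.exec_inp _ _ _ _).trans hin₅
  have hA' : HasColumns (selectedNodes N n ω) σ₆ A := exec_subMatrixStmt hin₅ hc hl fun i j => by
    rw [hσ₅, Stmt.exec_varr rfl, hσ₄, Stmt.exec_varr rfl, f₀]
    exact hA i j
  refine ⟨(Stmt.exec_inp _ _ _ _).trans hin₆, fun k hk => ?_, fun j hj => ?_, fun i j hj => ?_,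
    exec_svdStmt hin₆ hc hA' fun j hj k hk => ?_, fun k hk i hi => ?_⟩
  · rw [Stmt.exec_iarr rfl, hσ₆, Stmt.exec_iarr rfl, hσ₅, Stmt.exec_iarr rfl]
    exact hS k hk
  · rw [Stmt.exec_iarr rfl, hσ₆, Stmt.exec_iarr rfl]
    exact hl j hj
  · rw [Stmt.exec_varr rfl]
    exact hA' i j hj
  · rw [hσ₆, Stmt.exec_varr rfl, hσ₅, Stmt.exec_varr rfl, hσ₄, Stmt.exec_varr rfl, f₂]
    exact hu₂ j hj k hk
  · rw [Stmt.exec_varr rfl, hσ₆, Stmt.exec_varr rfl, hσ₅, Stmt.exec_varr rfl, hσ₄,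
      Stmt.exec_varr rfl]
    exact hu₃ k hk i hi

/-- The points that are clustered. -/
noncomputable def clusterPoints {K : ℕ} (v : Fin N → EuclideanSpace ℝ (Fin K)) :
    Model → Fin N → EuclideanSpace ℝ (Fin K)
  | .sbm => v
  | .dcsbm => fun i => ‖v i‖⁻¹ • v i

/-- The weights of the pairs. -/
noncomputable def modelWeight {K : ℕ} (v : Fin N → EuclideanSpace ℝ (Fin K)) :
    Model → Fin N → Fin N → ℝ
  | .sbm => fun _ _ => 1
  | .dcsbm => fun i j => ‖v i‖ * ‖v j‖

theorem exec_pointsStmt (h : Prepared n L q T A ω σ) {K k₁ : ℕ} (hk₁ : k₁ + 1 = K) (hK : K ≤ L)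
    (model : Model) :
    HasPoints ((pointsStmt model).exec ω (k₁ :: ρ) σ)
        (clusterPoints (embedding A (selectedNodes N n ω) L q ω K) model) ∧
      (model = .dcsbm → ∀ i : Fin N, ((pointsStmt model).exec ω (k₁ :: ρ) σ).varr 12 0 i =
        ‖embedding A (selectedNodes N n ω) L q ω K i‖) := by
  have hin := h.inp
  cases model with
  | sbm =>
    refine ⟨fun i d => ?_, fun h => by cases h⟩
    rw [pointsStmt, Stmt.exec_fillR (by decide) _ _ (by simp [hin]) (by simp [hin]; omega)]
    simp [clusterPoints, h.embedding hK]
  | dcsbm =>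
    rw [pointsStmt, Stmt.exec]
    set e : RExp := .un .sqrt (.sum 2 (.when (.lt (.var 0) (.var 3 + .const 1))
        (.get 8 (.var 1) (.var 0) * .get 8 (.var 1) (.var 0)))) with he
    set σ₁ := (Stmt.fillR 12 5 0 e).exec ω (k₁ :: ρ) σ with hσ₁
    have h₁ : Prepared n L q T A ω σ₁ := h.exec rfl
    have hin₁ := h₁.inp
    have hψ : ∀ i : Fin N, σ₁.varr 12 0 i = ‖embedding A (selectedNodes N n ω) L q ω K i‖ := by
      intro i
      rw [hσ₁, Stmt.exec_fillR (by decide) _ _ (by simp [hin]) (by simp [hin]),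
        ← norm_eq_of_coords hK (h.embedding hK i), he]
      simp [hin, hk₁]
    refine ⟨fun i d => ?_, fun _ i => ?_⟩
    · rw [Stmt.exec_fillR (by decide) _ _ (by simp [hin₁]) (by simp [hin₁]; omega)]
      simp [clusterPoints, h₁.embedding hK, hψ, div_eq_inv_mul]
    · rw [Stmt.exec_varr rfl, hψ]

/-- Writing the log-likelihood as criterion plus penalty gives one statement for both models. -/
theorem eval_logLikExp (hn : n ≤ N) (h : Prepared n L q T A ω σ) {K k₁ : ℕ} (hk₁ : k₁ + 1 = K)
    (hK : K ≤ L) (model : Model) {v : Fin N → EuclideanSpace ℝ (Fin K)}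
    (hv : v = embedding A (selectedNodes N n ω) L q ω K) {g : Fin N → ℕ}
    (hg : g = kmeans K T (clusterPoints v model) (startIndices N n L K ω))
    (ho : ∀ k < K, ∀ l < K, σ.varr 16 k l = edgeCount A (selectedNodes N n ω) g k l)
    (hw : ∀ k < K, ∀ l < K, σ.varr 17 k l =
      ∑ e ∈ pairsBetween (selectedNodes N n ω) g k l, modelWeight v model e.1 e.2)
    (hψ : model = .dcsbm → ∀ i : Fin N, σ.varr 12 0 i = ‖v i‖) :
    (logLikExp model).eval (k₁ :: ρ) σ = criterion A n L q T ω model K + penalty N n K := by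
  have hc : (selectedNodes N n ω).card = n := card_selectedNodes hn
  cases model with
  | sbm =>
    have hcrit : criterion A n L q T ω .sbm K = logLikSBM A (selectedNodes N n ω) K g
        (fun k l => edgeCount A (selectedNodes N n ω) g k l /
          pairCount (selectedNodes N n ω) g k l) - penalty N n K := by
      rw [hg, hv]; rfl
    have hw' : ∀ k < K, ∀ l < K, σ.varr 17 k l = pairCount (selectedNodes N n ω) g k l := by
      intro k hk l hl
      rw [hw k hk l hl]
      simp [modelWeight, pairCount]
    rw [hcrit, sub_add_cancel, logLikExp, logLikSBM]
    refine eval_labelPairsExp (f := fun k l =>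
      edgeCount A (selectedNodes N n ω) g k l * Real.log
        (edgeCount A (selectedNodes N n ω) g k l / pairCount (selectedNodes N n ω) g k l) +
      (pairCount (selectedNodes N n ω) g k l - edgeCount A (selectedNodes N n ω) g k l) *
        Real.log (1 - edgeCount A (selectedNodes N n ω) g k l /
          pairCount (selectedNodes N n ω) g k l)) h.inp hk₁ hK fun k hk l hl => ?_
    simp [edgesExp, weightsExp, ho k hk l hl, hw' k hk l hl]
  | dcsbm =>
    have hcrit : criterion A n L q T ω .dcsbm K = logLikDCSBM A (selectedNodes N n ω) K g
        (fun k l => edgeCount A (selectedNodes N n ω) g k l /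
          pairWeight (selectedNodes N n ω) g (fun i => ‖v i‖) k l) (fun i => ‖v i‖) -
          penalty N n K := by
      rw [hg, hv]; rfl
    have hw' : ∀ k < K, ∀ l < K,
        σ.varr 17 k l = pairWeight (selectedNodes N n ω) g (fun i => ‖v i‖) k l := hw
    rw [hcrit, sub_add_cancel, logLikExp, logLikDCSBM, RExp.eval_add]
    congr 1
    · refine eval_sum_pairs (f := fun i j => A i j * Real.log (‖v i‖ * ‖v j‖)) h.inp hc
        fun i j hj => ?_
      rw [RExp.eval_when]
      refine if_congr (eval_pairExp h.counts h.list i hj) ?_ rfl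
      simp [h.columns i j hj, h.list j hj, hψ]
    · refine eval_labelPairsExp (f := fun k l =>
        edgeCount A (selectedNodes N n ω) g k l * Real.log
          (edgeCount A (selectedNodes N n ω) g k l /
            pairWeight (selectedNodes N n ω) g (fun i => ‖v i‖) k l) -
        pairWeight (selectedNodes N n ω) g (fun i => ‖v i‖) k l *
          (edgeCount A (selectedNodes N n ω) g k l /
            pairWeight (selectedNodes N n ω) g (fun i => ‖v i‖) k l)) h.inp hk₁ hK
        fun k hk l hl => ?_
      simp [edgesExp, weightsExp, ho k hk l hl, hw' k hk l hl]

theorem exec_candidateStmt (hn : n ≤ N) (h : Prepared n L q T A ω σ) {k₁ : ℕ} (hk₁ : k₁ < L)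
    (model : Model) :
    ((candidateStmt model).exec ω (k₁ :: ρ) σ).varr 18 0 k₁ =
        - criterion A n L q T ω model (k₁ + 1) ∧
      ∀ k, k ≠ k₁ → ((candidateStmt model).exec ω (k₁ :: ρ) σ).varr 18 0 k = σ.varr 18 0 k := by
  have hc : (selectedNodes N n ω).card = n := card_selectedNodes hn
  rw [candidateStmt, Stmt.exec, Stmt.exec, Stmt.exec, Stmt.exec, Stmt.exec]
  set σ₁ := (selectStmt 2 (.get 3 (.var 1) (.var 0)) (.cast (.var 1 + .const 1))).exec ω
    (k₁ :: ρ) σ with hσ₁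
  have h₁ : Prepared n L q T A ω σ₁ := h.exec rfl
  have hR : HasCounts σ₁ 2 (startIndices N n L (k₁ + 1) ω) := by
    intro k hk
    rw [startIndices, ← selectedBefore_eq_countBelow _ _ k hk, hσ₁]
    refine exec_selectStmt (by simp [h.inp]) (fun i τ hi hτ hτ' => ?_) (fun i τ hτ => ?_) hk
    -- The loop variable is the candidate minus one, which is the factor `K - 1` in the tape offset
    -- of `startIndices`.
    · simp [hτ', h.tape k₁ hk₁ i hi]
    · simp
  set σ₂ := (pointsStmt model).exec ω (k₁ :: ρ) σ₁ with hσ₂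
  have h₂ : Prepared n L q T A ω σ₂ := h₁.exec (by cases model <;> rfl)
  obtain ⟨hp, hψ⟩ := exec_pointsStmt (ρ := ρ) h₁ (K := k₁ + 1) rfl hk₁ model
  rw [← hσ₂] at hp hψ
  set v := SMBIC.embedding A (selectedNodes N n ω) L q ω (k₁ + 1) with hv
  set σ₃ := kmeansStmt.exec ω (k₁ :: ρ) σ₂ with hσ₃
  have h₃ : Prepared n L q T A ω σ₃ := h₂.exec rfl
  set g := kmeans (k₁ + 1) T (clusterPoints v model) (startIndices N n L (k₁ + 1) ω) with hg
  have hg₃ : HasLabels σ₃ g := exec_kmeansStmt h₂.inp rfl hk₁ hp fun k hk => by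
    rw [hσ₂, Stmt.exec_iarr (by cases model <;> rfl)]
    exact hR k hk
  set σ₄ := edgeCountStmt.exec ω (k₁ :: ρ) σ₃ with hσ₄
  have h₄ : Prepared n L q T A ω σ₄ := h₃.exec rfl
  have hg₄ : HasLabels σ₄ g := fun i => by rw [hσ₄, Stmt.exec_iarr rfl]; exact hg₃ i
  set σ₅ := (weightStmt model).exec ω (k₁ :: ρ) σ₄ with hσ₅
  have h₅ : Prepared n L q T A ω σ₅ := h₄.exec (by cases model <;> rfl)
  have f₁₂ : σ₅.varr 12 = σ₂.varr 12 := by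
    rw [hσ₅, Stmt.exec_varr (by cases model <;> rfl), hσ₄, Stmt.exec_varr rfl, hσ₃,
      Stmt.exec_varr rfl]
  have f₁₂' : σ₄.varr 12 = σ₂.varr 12 := by
    rw [hσ₄, Stmt.exec_varr rfl, hσ₃, Stmt.exec_varr rfl]
  have ho : ∀ k < k₁ + 1, ∀ l < k₁ + 1,
      σ₅.varr 16 k l = edgeCount A (selectedNodes N n ω) g k l := by
    intro k hk l hl
    rw [hσ₅, Stmt.exec_varr (by cases model <;> rfl), hσ₄, edgeCountStmt,
      Stmt.exec_fillR (by decide) _ _ (by simp [h₃.inp]; omega) (by simp [h₃.inp]; omega),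
      eval_betweenExp (f := fun i j => A i j) h₃.inp hc h₃.counts h₃.list hg₃, edgeCount]
    intro i j hj
    simp [h₃.columns i j hj]
  have hw : ∀ k < k₁ + 1, ∀ l < k₁ + 1, σ₅.varr 17 k l =
      ∑ e ∈ pairsBetween (selectedNodes N n ω) g k l, modelWeight v model e.1 e.2 := by
    intro k hk l hl
    rw [hσ₅, weightStmt, Stmt.exec_fillR (by cases model <;> decide) _ _
      (by simp [h₄.inp]; omega) (by simp [h₄.inp]; omega),
      eval_betweenExp (f := modelWeight v model) h₄.inp hc h₄.counts h₄.list hg₄]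
    intro i j hj
    cases model with
    | sbm => simp [weightExp, modelWeight]
    | dcsbm => simp [weightExp, modelWeight, h₄.list j hj, f₁₂', hψ rfl]
  constructor
  · have H := eval_logLikExp (ρ := ρ) hn h₅ rfl hk₁ model hv hg ho hw fun hm i => by
      rw [f₁₂, hψ hm]
    simp [Stmt.exec, Store.setR, eval_penaltyExp h₅.inp, H]
  · intro k hk
    have : σ₅.varr 18 = σ.varr 18 := by
      rw [hσ₅, Stmt.exec_varr (by cases model <;> rfl), hσ₄, Stmt.exec_varr rfl, hσ₃,
        Stmt.exec_varr rfl, hσ₂, Stmt.exec_varr (by cases model <;> rfl), hσ₁, Stmt.exec_varr rfl]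
    simp [Stmt.exec, Store.setR, hk, this]

theorem exec_bicStmt (hn : n ≤ N) (hL : 1 ≤ L) (hin : σ.inp = inputs N n L q T)
    (hA : HasMatrix σ 0 A) (hd : σ.draws = 0) (model : Model) :
    ((bicStmt model).exec ω [] σ).iarr 5 0 = sInf {k | k < L ∧ ∀ l < L,
      - criterion A n L q T ω model (k + 1) ≤ - criterion A n L q T ω model (l + 1)} := by
  rw [bicStmt, Stmt.exec, Stmt.exec]
  set σ₁ := prepareStmt.exec ω [] σ with hσ₁
  have h₁ : Prepared n L q T A ω σ₁ := exec_prepareStmt hn hin hA hd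
  have := Stmt.exec_loop (ω := ω) (b := 2) (s := candidateStmt model) (ρ := []) (σ := σ₁)
    (fun k τ => Prepared n L q T A ω τ ∧
      ∀ l < k, τ.varr 18 0 l = - criterion A n L q T ω model (l + 1)) ⟨h₁, by simp⟩ ?_
  · rw [h₁.inp, inputs_two] at this
    obtain ⟨h₂, h₃⟩ := this
    rw [Stmt.exec_fillI (by decide) _ _ (by simp [h₁.inp])]
    refine eval_argminExp (k₁ := L) (d := fun k => - criterion A n L q T ω model (k + 1))
      ((Stmt.exec_inp _ _ _ _).trans h₁.inp) hL le_rfl ?_ (by simp [h₁.inp]) (by simp [h₁.inp])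
    intro k hk
    rw [← h₃ k hk]
    simp
  · rintro k τ hk hτ ⟨h, h'⟩
    rw [h₁.inp, inputs_two] at hk
    obtain ⟨g, g'⟩ := exec_candidateStmt (ρ := []) hn h hk model
    refine ⟨h.exec (by cases model <;> rfl), fun l hl => ?_⟩
    rcases Nat.lt_succ_iff_lt_or_eq.1 hl with hl | rfl
    · rw [g' l hl.ne, h' l hl]
    · exact g

end

-- Step count and output of the machine program.

theorem bicProgram_halts (model : Model) {N n L q T : ℕ} (hL : 1 ≤ L) (hLn : L ≤ n) (hn : n ≤ N)
    (A : Matrix (Fin N) (Fin N) ℝ) (ω : Tape) :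
    Halts ω (bicProgram model) (inputMemory N n L q T A)
      (((bicStmt model).cost (inputs 1 1 L q T) + 5) * (N * n))
      (fun m => m.idx 0 ∈ Set.Icc 1 L ∧
        IsMaxOn (criterion A n L q T ω model) (Set.Icc 1 L) (m.idx 0)) := by
  set m₀ := (inputMemory N n L q T A).setIdx 5 1 with hm₀
  have hin : m₀.store.inp = inputs N n L q T := by
    funext r
    fin_cases r <;> simp [hm₀, Memory.store, inputMemory, inputs]
  have hA : HasMatrix m₀.store 0 A := fun i j => by
    simp [hm₀, Memory.store, inputMemory]
  have hcost : (bicStmt model).cost m₀.store.inp ≤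
      (bicStmt model).cost (inputs 1 1 L q T) * (N * n) := by
    have := (bicStmt model).cost_le (β := m₀.store.inp) (by simp [hin]; omega)
      (by simp [hin]; omega)
    rw [(bicStmt_deg model).1, (bicStmt_deg model).2, hin] at this
    have hu : unitSize (inputs N n L q T) = inputs 1 1 L q T := by
      funext r
      fin_cases r <;> rfl
    rw [hin]
    simpa [hu] using this
  -- This absorbs the five instructions outside the compiled code, one before it and four after it.
  have hNn : 1 ≤ N * n := Nat.mul_pos (by omega) (by omega)
  have hrep : Rep 6 [] [] m₀.store m₀ := ⟨le_rfl, by simp, rfl, rfl⟩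
  refine .act_seq (T₂ := (bicStmt model).cost m₀.store.inp + 4)
    (.seq ((bicStmt model).halts ω hrep) (fun m₁ ⟨_, h₁⟩ =>
      .act_seq (T := 4) (.act_seq (.act_seq (.act ?_) le_rfl) le_rfl) le_rfl) le_rfl) ?_
  · have hout := exec_bicStmt (ω := ω) hn hL hin hA rfl model
    rw [← h₁] at hout
    set s := {k | k < L ∧ ∀ l < L,
      - criterion A n L q T ω model (k + 1) ≤ - criterion A n L q T ω model (l + 1)} with hs
    have hne : s.Nonempty := by
      obtain ⟨k, hk, hmin⟩ := Finset.exists_min_image (Finset.range L)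
        (fun k => - criterion A n L q T ω model (k + 1)) ⟨0, Finset.mem_range.2 hL⟩
      exact ⟨k, Finset.mem_range.1 hk, fun l hl => hmin l (Finset.mem_range.2 hl)⟩
    obtain ⟨hmem, hmax⟩ := Nat.sInf_mem hne
    have hout' : m₁.iarr 5 0 = sInf s := hout
    simp only [Instr.step, Memory.setIdx_idx, Memory.setIdx_iarr, Function.update_self, ne_eq,
      OfNat.zero_ne_ofNat, not_false_eq_true, Function.update_of_ne, hout']
    -- The final addition of 1 turns the minimising index in `{0, …, L - 1}` into a candidate in
    -- `{1, …, L}`.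
    refine ⟨⟨by omega, hmem⟩, fun K hK => ?_⟩
    obtain ⟨l, rfl⟩ : ∃ l, K = l + 1 := ⟨K - 1, by have := hK.1; omega⟩
    exact neg_le_neg_iff.1 (hmax l hK.2)
  · rw [add_mul]
    omega

end SMBIC

theorem proposition1 :
    -- the set of selected nodes is a simple random sample of `n` of the `N` nodes
    (∀ (N n : ℕ) (U : Finset (Fin N)), U.card = n →
      SMBIC.tapeLaw {ω | SMBIC.selectedNodes N n ω = U} = ((N.choose n : ENNReal))⁻¹) ∧
    -- for both models one program selects the number of communities by SM-BIC in `O(N n)` steps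
    ∀ model : SMBIC.Model, ∃ P : SMBIC.Program, ∀ Kmax q T : ℕ, 1 ≤ Kmax → ∃ C : ℕ,
      ∀ N n : ℕ, Kmax ≤ n → n ≤ N → ∀ (G : SimpleGraph (Fin N)) [DecidableRel G.Adj]
        (ω : SMBIC.Tape), ∃ (t : ℕ) (m : SMBIC.Memory),
          SMBIC.Run ω P (SMBIC.inputMemory N n Kmax q T (G.adjMatrix ℝ)) t m ∧
          t ≤ C * (N * n) ∧
          m.idx 0 ∈ Set.Icc 1 Kmax ∧
          IsMaxOn (SMBIC.criterion (G.adjMatrix ℝ) n Kmax q T ω model) (Set.Icc 1 Kmax)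
            (m.idx 0) :=
  ⟨SMBIC.tapeLaw_selectedNodes, fun model => ⟨SMBIC.bicProgram model, fun Kmax q T hK =>
    ⟨(SMBIC.bicStmt model).cost (SMBIC.inputs 1 1 Kmax q T) + 5, fun _ _ hKn hn G _ ω =>
      SMBIC.bicProgram_halts model hK hKn hn (G.adjMatrix ℝ) ω⟩⟩⟩
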